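/- Let $d\ge 1$ and write $|\cdot|$ for the Lebesgue measure on $\mathbb{R}^d$. For a Lebesgue measurable set $\Omega\subset\mathbb{R}^d$ with $|\Omega|<\infty$ let $$\widetilde H^1_0(\Omega)=\{u\in H^1(\mathbb{R}^d):\ u=0\ \text{a.e. on}\ \mathbb{R}^d\setminus\Omega\},$$ let $w_\Omega\in\widetilde H^1_0(\Omega)$ be the weak solution of $-\Delta w_\Omega=1$, that is, $\int_\Omega\nabla w_\Omega\cdot\nabla v\,dx=\int_\Omega v\,dx$ for every $v\in\widetilde H^1_0(\Omega)$, and let $$\widetilde E(\Omega)=\min_{w\in\widetilde H^1_0(\Omega)}\Big(\tfrac12\int_\Omega|\nabla w|^2\,dx-\int_\Omega w\,dx\Big).$$ Let $P(\Omega)=\sup\{\int_\Omega \operatorname{div}X\,dx:\ X\in C^1_c(\mathbb{R}^d;\mathbb{R}^d),\ |X|\le 1\}\in[0,\infty]$ be the De Giorgi perimeter. A measurable set $\Omega\subset\mathbb{R}^d$ with $|\Omega|<\infty$ and $P(\Omega)<\infty$ is called an energy subsolution if there are constants $\varepsilon>0$ and $k>0$ such that $$\widetilde E(\Omega)+kP(\Omega)\le\widetilde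 E(U)+kP(U)$$ for every measurable $U\subset\Omega$ with $\|w_\Omega-w_U\|_{L^2(\mathbb{R}^d)}\le\varepsilon$. Then every energy subsolution $\Omega\subset\mathbb{R}^d$ is bounded up to a Lebesgue null set: there is $R\in\mathbb{R}$ such that $|\Omega\setminus B_R(0)|=0$. -/

import Mathlib

open MeasureTheory Metric
open scoped ENNReal ContDiff

noncomputable section

/-- The Euclidean space `ℝ^d`. -/
abbrev Euc (d : ℕ) : Type := EuclideanSpace ℝ (Fin d)

/-- `u ∈ H¹(ℝ^d)` with weak gradient `∇u = g`: both are square integrable, and the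
integration by parts formula holds against every test function in every direction. -/
structure IsH1With {d : ℕ} (u : Euc d → ℝ) (g : Euc d → Euc d) : Prop where
  memLp : MemLp u 2 volume
  memLp_grad : MemLp g 2 volume
  integral_by_parts : ∀ φ : Euc d → ℝ, ContDiff ℝ ∞ φ → HasCompactSupport φ → ∀ v : Euc d,
    ∫ x, u x * fderiv ℝ φ x v = - ∫ x, inner ℝ (g x) v * φ x

/-- `u` belongs to the Sobolev-like space `{u ∈ H¹(ℝ^d) : u = 0 a.e. on Ωᶜ}`, with `∇u = g`. -/
structure IsSobolevLike {d : ℕ} (Ω : Set (Euc d)) (u : Euc d → ℝ) (g : Euc d → Euc d) : Prop where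
  isH1 : IsH1With u g
  ae_eq_zero : ∀ᵐ x, x ∉ Ω → u x = 0

/-- `w = w_Ω` is the weak solution, in the Sobolev-like space of `Ω`, of `-Δ w = 1`
(unique up to a.e. equality when `Ω` has finite measure). -/
def IsTorsionFunction {d : ℕ} (Ω : Set (Euc d)) (w : Euc d → ℝ) : Prop :=
  ∃ g : Euc d → Euc d, IsSobolevLike Ω w g ∧
    ∀ (v : Euc d → ℝ) (h : Euc d → Euc d), IsSobolevLike Ω v h →
      ∫ x in Ω, inner ℝ (g x) (h x) = ∫ x in Ω, v x

/-- The functional `J(w) = ½ ∫_Ω |∇w|² - ∫_Ω w`, where `g = ∇w`. -/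
def torsionFunctional {d : ℕ} (Ω : Set (Euc d)) (w : Euc d → ℝ) (g : Euc d → Euc d) : ℝ :=
  (1 / 2) * (∫ x in Ω, ‖g x‖ ^ 2) - ∫ x in Ω, w x

/-- The energy of `Ω`: the minimum of `J` over the Sobolev-like space of `Ω`. -/
def energy {d : ℕ} (Ω : Set (Euc d)) : ℝ :=
  sInf {e : ℝ | ∃ (w : Euc d → ℝ) (g : Euc d → Euc d),
    IsSobolevLike Ω w g ∧ e = torsionFunctional Ω w g}

/-- The divergence of a vector field. -/
def divergence {d : ℕ} (X : Euc d → Euc d) (x : Euc d) : ℝ :=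
  ∑ i : Fin d, (fderiv ℝ X x (EuclideanSpace.single i 1)) i

/-- The (De Giorgi) perimeter of `Ω`: the supremum of `∫_Ω div X` over all compactly supported
`C¹` vector fields `X` with `|X| ≤ 1`. The supremum is nonnegative, since `X = 0` is admissible. -/
def perimeter {d : ℕ} (Ω : Set (Euc d)) : ℝ≥0∞ :=
  ⨆ (X : Euc d → Euc d) (_ : ContDiff ℝ 1 X) (_ : HasCompactSupport X) (_ : ∀ x, ‖X x‖ ≤ 1),
    ENNReal.ofReal (∫ x in Ω, divergence X x)

/-- Local energy subsolutions with respect to the perimeter. `NullMeasurableSet` is Lebesgue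
measurability. The inequality `E(Ω) + k P(Ω) ≤ E(U) + k P(U)` is void when `P(U) = ∞`, so it is
only required (as an inequality of real numbers) for `P(U) < ∞`. -/
structure IsEnergySubsolution {d : ℕ} (Ω : Set (Euc d)) : Prop where
  measurable : NullMeasurableSet Ω volume
  finite_volume : volume Ω < ⊤
  finite_perimeter : perimeter Ω < ⊤
  subsolution : ∃ ε : ℝ, 0 < ε ∧ ∃ k : ℝ, 0 < k ∧
    ∀ U : Set (Euc d), U ⊆ Ω → NullMeasurableSet U volume →
      ∀ wΩ wU : Euc d → ℝ, IsTorsionFunction Ω wΩ → IsTorsionFunction U wU →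
        eLpNorm (fun x => wΩ x - wU x) 2 volume ≤ ENNReal.ofReal ε →
        perimeter U < ⊤ →
        energy Ω + k * (perimeter Ω).toReal ≤ energy U + k * (perimeter U).toReal

end

/-! It is enough to bound Ω in each direction `e`. Let H_t be the half space ⟨e, x⟩ > t, let w be
the torsion function of Ω, and put Y(t) = ∫_{Ω ∩ H_t} (1 + w²), which tends to 0 as t → ∞. A De
Giorgi iteration shows that Y vanishes at a finite height.

Compare Ω with U = Ω \ H_s. Testing E(U) with a cut-off of w gives E(U) - E(Ω) ≤ C Y(t)/δ² for s ≥ t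
+ δ (`IsTorsionPair.energy_diff_le`). This difference also controls ‖w_Ω - w_U‖₂², so U is an
admissible competitor once t is large. If the volume of Ω ∩ H_σ drops at rate at most c just beyond
σ = s, then P(Ω \ H_s) + P(Ω ∩ H_s) ≤ P(Ω) + 2Lc (`perimeter_split`), and some s in [t + δ, t + 2δ)
has c ≤ Y(t)/δ (`exists_slope_le`). The subsolution inequality then yields P(Ω ∩ H_s) ≤ C Y(t)/δ².

The gain comes from small volume. If 2Y(t) ≤ |B_r| with r ≤ 1, the isoperimetric inequality bounds
|Ω ∩ H_s| by 2r P(Ω ∩ H_s), and the Poincaré inequality with the Caccioppoli identity bounds the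
tail of ∫ w² by C r² Y(t)/δ². Hence Y(t + 2δ) ≤ K r δ⁻² Y(t) (`tailMass_decay`). Since r may be of
order Y(t)^{1/d}, the decay is superlinear, and steps δ with a finite sum reach Y = 0
(`exists_eq_zero_of_decay`).

The Poincaré and isoperimetric inequalities share one device: on average over translations in B_r,
the overlap of u with its translate is at most (∫|u|)²/|B_r|. So some short translation moves half
of u off itself, at a cost bounded through the gradient or the perimeter. Neither the sign nor
boundedness of w is needed: the term w² in Y and w ≤ 1 + w² replace them. -/

/-! ### Pairings and norms in L². -/

section L2

variable {α : Type*} [MeasurableSpace α] {μ : Measure α}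
  {E : Type*} [NormedAddCommGroup E] [InnerProductSpace ℝ E]

lemma integrable_inner_of_memLp {f g : α → E} (hf : MemLp f 2 μ) (hg : MemLp g 2 μ) :
    Integrable (fun x => inner ℝ (f x) (g x)) μ := by
  have h := L2.integrable_inner (𝕜 := ℝ) (hf.toLp f) (hg.toLp g)
  refine h.congr ?_
  filter_upwards [hf.coeFn_toLp, hg.coeFn_toLp] with x h1 h2
  rw [h1, h2]

lemma inner_toLp_toLp {f g : α → E} (hf : MemLp f 2 μ) (hg : MemLp g 2 μ) :
    inner ℝ (hf.toLp f) (hg.toLp g) = ∫ x, inner ℝ (f x) (g x) ∂μ := by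
  rw [L2.inner_def]
  refine integral_congr_ae ?_
  filter_upwards [hf.coeFn_toLp, hg.coeFn_toLp] with x h1 h2
  rw [h1, h2]

lemma integrable_norm_sq_of_memLp {f : α → E} (hf : MemLp f 2 μ) :
    Integrable (fun x => ‖f x‖ ^ 2) μ := by
  simpa using integrable_inner_of_memLp hf hf

lemma norm_toLp_sq {f : α → E} (hf : MemLp f 2 μ) :
    ‖hf.toLp f‖ ^ 2 = ∫ x, ‖f x‖ ^ 2 ∂μ := by
  rw [← real_inner_self_eq_norm_sq, inner_toLp_toLp]
  simp

lemma norm_toLp_eq_sqrt {f : α → E} (hf : MemLp f 2 μ) :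
    ‖hf.toLp f‖ = √(∫ x, ‖f x‖ ^ 2 ∂μ) := by
  rw [← norm_toLp_sq hf, Real.sqrt_sq (norm_nonneg _)]

lemma abs_integral_inner_le {f g : α → E} (hf : MemLp f 2 μ) (hg : MemLp g 2 μ) :
    |∫ x, inner ℝ (f x) (g x) ∂μ| ≤ √(∫ x, ‖f x‖ ^ 2 ∂μ) * √(∫ x, ‖g x‖ ^ 2 ∂μ) := by
  rw [← inner_toLp_toLp hf hg, ← norm_toLp_eq_sqrt hf, ← norm_toLp_eq_sqrt hg]
  exact abs_real_inner_le_norm _ _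

lemma abs_integral_mul_le {f g : α → ℝ} (hf : MemLp f 2 μ) (hg : MemLp g 2 μ) :
    |∫ x, f x * g x ∂μ| ≤ √(∫ x, f x ^ 2 ∂μ) * √(∫ x, g x ^ 2 ∂μ) := by
  have := abs_integral_inner_le hf hg
  simpa [mul_comm] using this

end L2

/-! ### Density of test functions in L² and duality. -/

section Density

variable {E : Type*} [NormedAddCommGroup E] [NormedSpace ℝ E] [FiniteDimensional ℝ E]
  [MeasurableSpace E] [BorelSpace E] {μ : Measure E} [IsLocallyFiniteMeasure μ]

/-- The test functions form a subspace of `L²`. -/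
def testSubmodule (μ : Measure E) : Submodule ℝ (Lp ℝ 2 μ) where
  carrier := {f | ∃ φ : E → ℝ, ContDiff ℝ ∞ φ ∧ HasCompactSupport φ ∧ f =ᵐ[μ] φ}
  zero_mem' := ⟨fun _ => 0, contDiff_const, HasCompactSupport.zero, Lp.coeFn_zero _ _ _⟩
  add_mem' := by
    rintro f g ⟨φ, h1, h2, h3⟩ ⟨ψ, k1, k2, k3⟩
    exact ⟨φ + ψ, h1.add k1, h2.add k2, (Lp.coeFn_add f g).trans (h3.add k3)⟩
  smul_mem' := by
    rintro c f ⟨φ, h1, h2, h3⟩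
    refine ⟨c • φ, contDiff_const.smul h1, h2.smul_left (f := fun _ => c), ?_⟩
    exact (Lp.coeFn_smul c f).trans (h3.const_smul c)

lemma memLp_two_of_test {φ : E → ℝ} (h1 : Continuous φ) (h2 : HasCompactSupport φ) :
    MemLp φ 2 μ :=
  h1.memLp_of_hasCompactSupport h2

/-- The orthogonal complement is trivial: a function in it integrates to zero against every test
function, hence vanishes almost everywhere. -/
lemma dense_testSubmodule : (testSubmodule μ).topologicalClosure = ⊤ := by
  rw [Submodule.topologicalClosure_eq_top_iff, Submodule.eq_bot_iff]
  intro f hf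
  rw [Submodule.mem_orthogonal] at hf
  have : ∀ᵐ x ∂μ, f x = 0 := by
    refine ae_eq_zero_of_integral_contDiff_smul_eq_zero
      ((Lp.memLp f).locallyIntegrable (by norm_num)) ?_
    intro φ h1 h2
    have h3 : MemLp φ 2 μ := memLp_two_of_test h1.continuous h2
    have := hf (h3.toLp φ) ⟨φ, h1, h2, h3.coeFn_toLp⟩
    rw [L2.inner_def] at this
    rw [← this]
    refine integral_congr_ae ?_
    filter_upwards [h3.coeFn_toLp] with x hx
    simp [hx, mul_comm]
  exact (Lp.eq_zero_iff_ae_eq_zero).2 this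

lemma exists_test_integral_sub_sq_lt {f : E → ℝ} (hf : MemLp f 2 μ) {ε : ℝ} (hε : 0 < ε) :
    ∃ φ : E → ℝ, ContDiff ℝ ∞ φ ∧ HasCompactSupport φ ∧ √(∫ x, (f x - φ x) ^ 2 ∂μ) < ε := by
  have : hf.toLp f ∈ closure (testSubmodule μ : Set (Lp ℝ 2 μ)) := by
    have h := dense_testSubmodule (μ := μ)
    have h2 : hf.toLp f ∈ (testSubmodule μ).topologicalClosure := by rw [h]; trivial
    exact h2
  obtain ⟨g, ⟨φ, h1, h2, h3⟩, hg⟩ := Metric.mem_closure_iff.1 this ε hε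
  have hφ : MemLp φ 2 μ := memLp_two_of_test h1.continuous h2
  refine ⟨φ, h1, h2, ?_⟩
  have hg' : g = hφ.toLp φ := by
    apply Lp.ext
    exact h3.trans hφ.coeFn_toLp.symm
  rw [hg', dist_eq_norm, ← MemLp.toLp_sub, norm_toLp_eq_sqrt] at hg
  simpa using hg

/-- A function whose pairing with every test function `φ` is at most `M ‖φ‖₂` has `L²` norm at
most `M`. -/
lemma sqrt_integral_sq_le_of_test {f : E → ℝ} (hf : MemLp f 2 μ) {M : ℝ} (hM : 0 ≤ M)
    (h : ∀ φ : E → ℝ, ContDiff ℝ ∞ φ → HasCompactSupport φ →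
      |∫ x, f x * φ x ∂μ| ≤ M * √(∫ x, φ x ^ 2 ∂μ)) :
    √(∫ x, f x ^ 2 ∂μ) ≤ M := by
  have key : ∀ g ∈ (testSubmodule μ).topologicalClosure, |inner ℝ (hf.toLp f) g| ≤ M * ‖g‖ := by
    have hcl : IsClosed {g : Lp ℝ 2 μ | |inner ℝ (hf.toLp f) g| ≤ M * ‖g‖} :=
      isClosed_le (by fun_prop) (by fun_prop)
    refine fun g hg => closure_minimal ?_ hcl hg
    rintro g ⟨φ, h1, h2, h3⟩
    have hφ : MemLp φ 2 μ := memLp_two_of_test h1.continuous h2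
    have hg' : g = hφ.toLp φ := Lp.ext (h3.trans hφ.coeFn_toLp.symm)
    have := h φ h1 h2
    simp only [Set.mem_ofPred_eq]
    rw [hg', inner_toLp_toLp, norm_toLp_eq_sqrt]
    simpa [mul_comm] using this
  have := key (hf.toLp f) (by rw [dense_testSubmodule]; trivial)
  rw [real_inner_self_eq_norm_sq, abs_of_nonneg (by positivity), norm_toLp_eq_sqrt] at this
  simp only [Real.norm_eq_abs, sq_abs] at this
  -- With N the norm of `f`, the choice g = f gives N² ≤ M N; dividing requires N ≠ 0.
  rcases (Real.sqrt_nonneg (∫ x, f x ^ 2 ∂μ)).eq_or_lt with h0 | h0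
  · rw [← h0]; exact hM
  · nlinarith

end Density

/-! ### Differentiating pairings with translated test functions. -/

section Translation

variable {d : ℕ}

/-- The pairing is the convolution of `f` with the reflection of `φ`, evaluated along the line s ↦ s
• y, so differentiability is that of a convolution with a C¹ compactly supported function. -/
lemma hasDerivAt_integral_mul_translate {f φ : Euc d → ℝ} (hf : LocallyIntegrable f volume)
    (hφ : ContDiff ℝ 1 φ) (hc : HasCompactSupport φ) (y : Euc d) (s : ℝ) :
    HasDerivAt (fun s : ℝ => ∫ x, f x * φ (x - s • y))
      (-(∫ x, f x * fderiv ℝ φ (x - s • y) y)) s := by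
  set ψ : Euc d → ℝ := fun x => φ (-x) with hψ
  have hψ1 : ContDiff ℝ 1 ψ := hφ.comp contDiff_neg
  have hψc : HasCompactSupport ψ := hc.comp_homeomorph (Homeomorph.neg (Euc d))
  have h1 := hψc.hasFDerivAt_convolution_right (μ := volume) (ContinuousLinearMap.mul ℝ ℝ) hf hψ1
    (s • y)
  have h2 : HasDerivAt (fun s : ℝ => s • y) y s := by
    simpa using (hasDerivAt_id s).smul_const y
  have h3 := h1.comp_hasDerivAt s h2
  have hd : ∀ z, fderiv ℝ ψ z y = - fderiv ℝ φ (-z) y := by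
    intro z
    have : HasFDerivAt ψ ((fderiv ℝ φ (-z)).comp (-ContinuousLinearMap.id ℝ (Euc d))) z :=
      ((hφ.differentiable (by norm_num)) (-z)).hasFDerivAt.comp z (hasFDerivAt_id z).neg
    rw [this.fderiv]
    simp
  rw [convolution_precompR_apply _ hf (hψc.fderiv ℝ) (hψ1.continuous_fderiv (by norm_num))] at h3
  refine (h3.congr_deriv ?_).congr_of_eventuallyEq ?_
  · simp only [convolution, ContinuousLinearMap.mul_apply', hd, neg_sub, mul_neg, integral_neg]
  · refine Filter.Eventually.of_forall fun s => ?_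
    simp only [Function.comp, convolution, ContinuousLinearMap.mul_apply', hψ, neg_sub]

end Translation

/-! ### Translation estimate in H¹ and the Poincaré inequality. -/

section Translation

variable {d : ℕ}

lemma memLp_translate {E : Type*} [NormedAddCommGroup E] {f : Euc d → E} {p : ℝ≥0∞}
    (hf : MemLp f p volume) (y : Euc d) :
    MemLp (fun x => f (x + y)) p volume :=
  hf.comp_measurePreserving (measurePreserving_add_right volume y)

lemma IsH1With.abs_integral_mul_fderiv_le {u : Euc d → ℝ} {g : Euc d → Euc d} (h : IsH1With u g)
    {φ : Euc d → ℝ} (hφ : ContDiff ℝ ∞ φ) (hc : HasCompactSupport φ) (y : Euc d) :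
    |∫ x, u x * fderiv ℝ φ x y| ≤ ‖y‖ * √(∫ x, ‖g x‖ ^ 2) * √(∫ x, φ x ^ 2) := by
  have hφ2 : MemLp φ 2 volume := memLp_two_of_test hφ.continuous hc
  have hy : MemLp (fun x => φ x • y) 2 volume := by
    have := hφ2.norm.const_mul ‖y‖
    refine this.of_le ((hφ2.1.smul_const y)) (Filter.Eventually.of_forall fun x => ?_)
    simp [norm_smul, mul_comm]
  have := abs_integral_inner_le h.memLp_grad hy
  rw [h.integral_by_parts φ hφ hc y, abs_neg]
  simp only [inner_smul_right, norm_smul, mul_pow] at this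
  rw [integral_mul_const, Real.sqrt_mul' _ (by positivity), Real.sqrt_sq (norm_nonneg _)] at this
  simp only [Real.norm_eq_abs, sq_abs] at this
  calc _ = |∫ x, φ x * inner ℝ (g x) y| := by simp only [mul_comm]
    _ ≤ _ := this
    _ = _ := by ring

lemma contDiff_comp_sub {n : WithTop ℕ∞} {φ : Euc d → ℝ} (hφ : ContDiff ℝ n φ) (y : Euc d) :
    ContDiff ℝ n (fun x => φ (x - y)) := hφ.comp (contDiff_id.sub contDiff_const)

lemma hasCompactSupport_comp_sub {F : Type*} [Zero F] {φ : Euc d → F} (hφ : HasCompactSupport φ)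
    (y : Euc d) : HasCompactSupport (fun x => φ (x - y)) :=
  hφ.comp_homeomorph (Homeomorph.subRight y)

/-- By duality it suffices to pair with a test function. Translation is moved onto the test
function, where the derivative in s is an integration by parts bounded by ‖y‖ ‖g‖₂ ‖φ‖₂; the mean
value inequality on [0, 1] concludes. No approximation of `u` by smooth functions is involved. -/
lemma IsH1With.sqrt_integral_translate_sub_sq_le {u : Euc d → ℝ} {g : Euc d → Euc d}
    (h : IsH1With u g) (y : Euc d) :
    √(∫ x, (u (x + y) - u x) ^ 2) ≤ ‖y‖ * √(∫ x, ‖g x‖ ^ 2) := by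
  have hu := h.memLp
  have huy := memLp_translate hu y
  refine sqrt_integral_sq_le_of_test (huy.sub hu) (by positivity) fun φ hφ hc => ?_
  have hφ2 : MemLp φ 2 volume := memLp_two_of_test hφ.continuous hc
  set F : ℝ → ℝ := fun s : ℝ => ∫ x, u x * φ (x - s • y) with hF
  have hd : ∀ s : ℝ, HasDerivAt F (-(∫ x, u x * fderiv ℝ φ (x - s • y) y)) s := fun s =>
    hasDerivAt_integral_mul_translate (hu.locallyIntegrable (by norm_num))
      (hφ.of_le (by exact_mod_cast le_top)) hc y s
  have hb : ∀ s : ℝ, ‖-(∫ x, u x * fderiv ℝ φ (x - s • y) y)‖ ≤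
      ‖y‖ * √(∫ x, ‖g x‖ ^ 2) * √(∫ x, φ x ^ 2) := by
    intro s
    have := h.abs_integral_mul_fderiv_le (contDiff_comp_sub hφ (s • y))
      (hasCompactSupport_comp_sub hc (s • y)) y
    simp only [fderiv_comp_sub] at this
    rw [integral_sub_right_eq_self (fun x => φ x ^ 2)] at this
    rwa [norm_neg]
  have := norm_image_sub_le_of_norm_deriv_le_segment_01' (f := F)
    (fun s _ => (hd s).hasDerivWithinAt) (fun s _ => hb s)
  have e : ∫ x, ((fun x => u (x + y)) - u) x * φ x = F 1 - F 0 := by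
    have i1 : Integrable (fun x => u (x + y) * φ x) := huy.integrable_mul hφ2
    have i2 : Integrable (fun x => u x * φ x) := hu.integrable_mul hφ2
    simp only [Pi.sub_apply, sub_mul, hF, one_smul, zero_smul, sub_zero]
    rw [integral_sub i1 i2, ← integral_sub_right_eq_self (fun x => u (x + y) * φ x) y]
    simp
  rw [e]
  exact this

/-- Among the translations by vectors of a ball there is one for which the overlap of `u` with its
translate is at most the average. -/
lemma exists_translate_integral_mul_le {u : Euc d → ℝ} (hu : Integrable u) {r : ℝ} (hr : 0 < r) :
    ∃ y ∈ ball (0 : Euc d) r, (∫ x, |u x| * |u (x + y)|) * volume.real (ball (0 : Euc d) r) ≤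
      (∫ x, |u x|) ^ 2 := by
  set f : Euc d → ℝ := fun x => |u (-x)|
  set g : Euc d → ℝ := fun x => |u x|
  have hf : Integrable f := hu.abs.comp_neg
  have hg : Integrable g := hu.abs
  -- This convolution at y is exactly the overlap of |u| with its translate by y, and its total
  -- integral factors as (∫|u|)².
  set c := convolution f g (ContinuousLinearMap.mul ℝ ℝ) volume
  have hc : ∀ y, c y = ∫ x, |u x| * |u (x + y)| := by
    intro y
    simp only [c, convolution, ContinuousLinearMap.mul_apply', f, g]
    rw [← integral_neg_eq_self]
    simp [add_comm]
  have hci : Integrable c := hf.integrable_convolution (ContinuousLinearMap.mul ℝ ℝ) hg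
  have hcint : ∫ y, c y = (∫ x, |u x|) ^ 2 := by
    simp only [c]
    rw [integral_convolution _ hf hg]
    simp only [f, g, ContinuousLinearMap.mul_apply', sq]
    rw [integral_neg_eq_self (fun x => |u x|)]
  have h0 : volume (ball (0 : Euc d) r) ≠ 0 := (measure_ball_pos _ _ hr).ne'
  have h1 : volume (ball (0 : Euc d) r) ≠ ⊤ := measure_ball_lt_top.ne
  obtain ⟨y, hy, hle⟩ := exists_le_setAverage h0 h1 hci.integrableOn
  refine ⟨y, hy, ?_⟩
  rw [setAverage_eq, smul_eq_mul, hc] at hle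
  have hpos : 0 < volume.real (ball (0 : Euc d) r) := ENNReal.toReal_pos h0 h1
  rw [inv_mul_eq_div, le_div_iff₀ hpos] at hle
  refine hle.trans ?_
  rw [← hcint]
  refine setIntegral_le_integral hci (Filter.Eventually.of_forall fun y => ?_)
  rw [Pi.zero_apply, hc]
  positivity

lemma integrable_of_memLp_two_of_ae_eq_zero {A : Set (Euc d)} (hA' : volume A < ⊤) {E : Type*} [NormedAddCommGroup E]
    {u : Euc d → E}
    (hu : MemLp u 2 volume) (h0 : ∀ᵐ x, x ∉ A → u x = 0) : Integrable u := by
  have : IsFiniteMeasure (volume.restrict A) := ⟨by simpa using hA'⟩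
  have h1 : IntegrableOn u A := (hu.restrict A).integrable (by norm_num)
  exact h1.integrable_of_ae_notMem_eq_zero h0

lemma sq_integral_abs_le {A : Set (Euc d)} (hA' : volume A < ⊤) {u : Euc d → ℝ}
    (hu : MemLp u 2 volume) (h0 : ∀ᵐ x, x ∉ A → u x = 0) :
    (∫ x, |u x|) ^ 2 ≤ volume.real A * ∫ x, u x ^ 2 := by
  have : IsFiniteMeasure (volume.restrict A) := ⟨by simpa using hA'⟩
  have h1 : ∫ x, |u x| = ∫ x in A, |u x| := by
    refine (setIntegral_eq_integral_of_ae_compl_eq_zero ?_).symm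
    filter_upwards [h0] with x hx h; rw [hx h, abs_zero]
  have h2 : ∫ x, u x ^ 2 = ∫ x in A, u x ^ 2 := by
    refine (setIntegral_eq_integral_of_ae_compl_eq_zero ?_).symm
    filter_upwards [h0] with x hx h; rw [hx h]; simp
  have := abs_integral_mul_le (μ := volume.restrict A) (f := fun _ => (1 : ℝ)) (g := fun x => |u x|)
    (memLp_const 1) ((hu.restrict A).abs)
  simp only [one_mul, one_pow, sq_abs] at this
  rw [h1, h2]
  rw [integral_const, smul_eq_mul, mul_one, measureReal_restrict_apply_univ] at this
  rw [abs_of_nonneg (by positivity)] at this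
  calc _ ≤ (√(volume.real A) * √(∫ x in A, u x ^ 2)) ^ 2 := by gcongr
    _ = _ := by
      rw [mul_pow, Real.sq_sqrt (by positivity), Real.sq_sqrt (by positivity)]

/-- Poincaré inequality for functions supported in a set of small measure. -/
lemma IsSobolevLike.integral_sq_le {A : Set (Euc d)} (hA' : volume A < ⊤) {u : Euc d → ℝ} {g : Euc d → Euc d}
    (h : IsSobolevLike A u g) {r : ℝ} (hr : 0 < r)
    (hball : 2 * volume.real A ≤ volume.real (ball (0 : Euc d) r)) :
    ∫ x, u x ^ 2 ≤ r ^ 2 * ∫ x, ‖g x‖ ^ 2 := by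
  have hu := h.isH1.memLp
  obtain ⟨y, hy, hle⟩ := exists_translate_integral_mul_le
    (integrable_of_memLp_two_of_ae_eq_zero hA' hu h.ae_eq_zero) hr
  have hsq := sq_integral_abs_le hA' hu h.ae_eq_zero
  have huy := memLp_translate hu y
  have hB : 0 < volume.real (ball (0 : Euc d) r) :=
    ENNReal.toReal_pos (measure_ball_pos _ _ hr).ne' measure_ball_lt_top.ne
  have hI : 0 ≤ ∫ x, u x ^ 2 := by positivity
  -- Cauchy–Schwarz on A bounds (∫|u|)² by |A| ∫u², and 2|A| ≤ |B_r| makes the overlap at most half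
  -- of ∫u².
  have h1 : ∫ x, |u x| * |u (x + y)| ≤ (1 / 2) * ∫ x, u x ^ 2 := by
    have : (∫ x, |u x| * |u (x + y)|) * volume.real (ball (0 : Euc d) r) ≤
      ((1 / 2) * ∫ x, u x ^ 2) * volume.real (ball (0 : Euc d) r) := by nlinarith
    exact le_of_mul_le_mul_right this hB
  have h2 : ∫ x, u x * u (x + y) ≤ ∫ x, |u x| * |u (x + y)| := by
    refine integral_mono (hu.integrable_mul huy) (hu.abs.integrable_mul huy.abs) fun x => ?_
    simp only [← abs_mul]
    exact le_abs_self _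
  have h3 : ∫ x, (u (x + y) - u x) ^ 2 ≤ ‖y‖ ^ 2 * ∫ x, ‖g x‖ ^ 2 := by
    have := h.isH1.sqrt_integral_translate_sub_sq_le y
    have h4 := pow_le_pow_left₀ (Real.sqrt_nonneg _) this 2
    rwa [mul_pow, Real.sq_sqrt (by positivity), Real.sq_sqrt (by positivity)] at h4
  -- Expanding the square: since the overlap is at most half of ∫u², the translation error is at
  -- least ∫u².
  have h5 : ∫ x, (u (x + y) - u x) ^ 2 = 2 * (∫ x, u x ^ 2) - 2 * ∫ x, u x * u (x + y) := by
    have i1 : Integrable (fun x => u x ^ 2) := hu.integrable_sq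
    have i2 : Integrable (fun x => u (x + y) ^ 2) := huy.integrable_sq
    have i3 : Integrable (fun x => u x * u (x + y)) := hu.integrable_mul huy
    have e : ∀ x, (u (x + y) - u x) ^ 2 = u (x + y) ^ 2 + (u x ^ 2 - 2 * (u x * u (x + y))) :=
      fun x => by ring
    simp only [e]
    have i4 : Integrable (fun x => u x ^ 2 - 2 * (u x * u (x + y))) := i1.sub (i3.const_mul 2)
    rw [integral_add i2 i4, integral_sub i1 (i3.const_mul 2),
      integral_const_mul,
      integral_add_right_eq_self (fun x => u x ^ 2) y]
    ring
  have h6 : ‖y‖ ^ 2 ≤ r ^ 2 := by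
    have : ‖y‖ < r := by simpa using hy
    gcongr
  have h7 : 0 ≤ ∫ x, ‖g x‖ ^ 2 := by positivity
  nlinarith

end Translation

/-! ### Perimeter, translations and the isoperimetric inequality. -/

section Perimeter

variable {d : ℕ}

lemma ofReal_setIntegral_divergence_le_perimeter (A : Set (Euc d)) {X : Euc d → Euc d}
    (hX : ContDiff ℝ 1 X) (hc : HasCompactSupport X) (h1 : ∀ x, ‖X x‖ ≤ 1) :
    ENNReal.ofReal (∫ x in A, divergence X x) ≤ perimeter A :=
  le_iSup_of_le X (le_iSup_of_le hX (le_iSup_of_le hc (le_iSup_of_le h1 le_rfl)))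

lemma setIntegral_divergence_le_perimeter {A : Set (Euc d)} (hP : perimeter A < ⊤)
    {X : Euc d → Euc d}
    (hX : ContDiff ℝ 1 X) (hc : HasCompactSupport X) (h1 : ∀ x, ‖X x‖ ≤ 1) :
    ∫ x in A, divergence X x ≤ (perimeter A).toReal :=
  (ENNReal.ofReal_le_iff_le_toReal hP.ne).1 (ofReal_setIntegral_divergence_le_perimeter A hX hc h1)

lemma divergence_smul_const {φ : Euc d → ℝ} (hφ : ContDiff ℝ 1 φ) (y : Euc d) (x : Euc d) :
    divergence (fun x => φ x • y) x = fderiv ℝ φ x y := by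
  have hd : DifferentiableAt ℝ φ x := hφ.differentiable (by norm_num) x
  have : fderiv ℝ (fun x => φ x • y) x = (fderiv ℝ φ x).smulRight y :=
    (hd.hasFDerivAt.smul_const y).fderiv
  simp only [divergence, this, ContinuousLinearMap.smulRight_apply, PiLp.smul_apply, smul_eq_mul]
  conv_rhs => rw [← (EuclideanSpace.basisFun (Fin d) ℝ).sum_repr y]
  simp [mul_comm]

lemma setIntegral_fderiv_le {A : Set (Euc d)} (hP : perimeter A < ⊤) {φ : Euc d → ℝ}
    (hφ : ContDiff ℝ 1 φ) (hc : HasCompactSupport φ) (h1 : ∀ x, |φ x| ≤ 1) (y : Euc d) :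
    ∫ x in A, fderiv ℝ φ x y ≤ ‖y‖ * (perimeter A).toReal := by
  rcases eq_or_ne y 0 with rfl | hy
  · simp
  have hy' : 0 < ‖y‖ := norm_pos_iff.2 hy
  -- The field φ y/‖y‖ is admissible, and its divergence is the directional derivative of φ up to
  -- the factor ‖y‖⁻¹.
  have := setIntegral_divergence_le_perimeter hP (X := fun x => φ x • (‖y‖⁻¹ • y))
    (hφ.smul contDiff_const) hc.smul_right (fun x => by
      rw [norm_smul, norm_smul, norm_inv, norm_norm, inv_mul_cancel₀ hy'.ne', mul_one]
      exact h1 x)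
  simp only [divergence_smul_const hφ, map_smul, smul_eq_mul] at this
  rw [integral_const_mul, inv_mul_le_iff₀ hy'] at this
  exact this

lemma setIntegral_mul_eq_integral_indicator_mul {A : Set (Euc d)} (hA : NullMeasurableSet A volume)
    (f : Euc d → ℝ) : ∫ x, A.indicator 1 x * f x = ∫ x in A, f x := by
  rw [← integral_indicator₀ hA]
  congr 1
  ext x
  by_cases hx : x ∈ A <;> simp [hx]

lemma integrable_indicator_one {A : Set (Euc d)} (hA : NullMeasurableSet A volume)
    (hA' : volume A < ⊤) : Integrable (A.indicator (1 : Euc d → ℝ)) :=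
  IntegrableOn.integrable_indicator₀ (integrableOn_const hA'.ne) hA

lemma integral_indicator_one_eq {A : Set (Euc d)} (hA : NullMeasurableSet A volume) :
    ∫ x, A.indicator (1 : Euc d → ℝ) x = volume.real A := by
  rw [integral_indicator₀ hA]
  simp

/-- The analogue for indicators of the H¹ translation estimate: the perimeter bounds the derivative
in s, with the sup norm of φ in the role of its L² norm. -/
lemma abs_setIntegral_sub_translate_le {A : Set (Euc d)} (hA : NullMeasurableSet A volume)
    (hA' : volume A < ⊤) (hP : perimeter A < ⊤) {φ : Euc d → ℝ}
    (hφ : ContDiff ℝ 1 φ) (hc : HasCompactSupport φ) (h1 : ∀ x, |φ x| ≤ 1) (y : Euc d) :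
    |(∫ x in A, φ (x - y)) - ∫ x in A, φ x| ≤ ‖y‖ * (perimeter A).toReal := by
  set F : ℝ → ℝ := fun s : ℝ => ∫ x, A.indicator 1 x * φ (x - s • y) with hF
  have hd : ∀ s : ℝ, HasDerivAt F (-(∫ x, A.indicator 1 x * fderiv ℝ φ (x - s • y) y)) s := fun s =>
    hasDerivAt_integral_mul_translate (integrable_indicator_one hA hA').locallyIntegrable hφ hc y s
  have hb : ∀ s : ℝ, ‖-(∫ x, A.indicator 1 x * fderiv ℝ φ (x - s • y) y)‖ ≤
      ‖y‖ * (perimeter A).toReal := by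
    intro s
    rw [norm_neg, setIntegral_mul_eq_integral_indicator_mul hA, Real.norm_eq_abs, abs_le']
    have h := fun z => setIntegral_fderiv_le hP (contDiff_comp_sub hφ (s • y))
      (hasCompactSupport_comp_sub hc (s • y)) (fun x => h1 _) z
    simp only [fderiv_comp_sub] at h
    refine ⟨h y, ?_⟩
    simpa [integral_neg] using h (-y)
  have := norm_image_sub_le_of_norm_deriv_le_segment_01' (f := F)
    (fun s _ => (hd s).hasDerivWithinAt) (fun s _ => hb s)
  simpa only [hF, setIntegral_mul_eq_integral_indicator_mul hA, one_smul, zero_smul, sub_zero,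
    Real.norm_eq_abs] using this

lemma exists_test_integral_indicator_sub_le {A : Set (Euc d)} (hA : NullMeasurableSet A volume)
    (hA' : volume A < ⊤) {ε : ℝ} (hε : 0 < ε) :
    ∃ φ : Euc d → ℝ, ContDiff ℝ ∞ φ ∧ HasCompactSupport φ ∧ (∀ x, 0 ≤ φ x ∧ φ x ≤ 1) ∧
      ∫ x, |A.indicator 1 x - φ x| ≤ ε := by
  wlog hm : MeasurableSet A generalizing A
  · have he := hA.toMeasurable_ae_eq
    obtain ⟨φ, h1, h2, h3, h4⟩ := this (A := toMeasurable volume A)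
      (measurableSet_toMeasurable _ _).nullMeasurableSet (by rwa [measure_toMeasurable])
      (measurableSet_toMeasurable _ _)
    refine ⟨φ, h1, h2, h3, ?_⟩
    refine (integral_congr_ae ?_).trans_le h4
    filter_upwards [indicator_ae_eq_of_ae_eq_set (f := (1 : Euc d → ℝ)) he] with x hx
    rw [hx]
  have hε' : ENNReal.ofReal (ε / 2) ≠ 0 := by simpa using hε
  obtain ⟨K, hKA, hK, hAK⟩ := hm.exists_isCompact_sdiff_lt hA'.ne hε'
  obtain ⟨U, hKU, hU, hUK⟩ := hK.exists_isOpen_lt_add (μ := volume) hε'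
  -- Intersecting with a bounded neighbourhood of K makes the support compact. `U` need not contain
  -- A: the error is at most 1 and lives in (A \ K) ∪ (U \ K).
  have hO : IsOpen (U ∩ thickening 1 K) := hU.inter isOpen_thickening
  have hKO : K ⊆ U ∩ thickening 1 K :=
    Set.subset_inter hKU (self_subset_thickening one_pos K)
  obtain ⟨φ, h1, h2, h3, h4⟩ := exists_contMDiff_support_eq_eq_one_iff (n := ⊤)
    (modelWithCornersSelf ℝ (Euc d)) hO hK.isClosed hKO
  have hφ01 : ∀ x, 0 ≤ φ x ∧ φ x ≤ 1 := fun x => h2 (Set.mem_range_self x)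
  refine ⟨φ, h1.contDiff, ?_, hφ01, ?_⟩
  · refine HasCompactSupport.of_support_subset_isCompact
      (Metric.isCompact_of_isClosed_isBounded isClosed_cthickening
        (hK.isBounded.cthickening (δ := 1))) ?_
    rw [h3]
    exact Set.inter_subset_right.trans (thickening_subset_cthickening _ _)
  have hUm : volume (U \ K) ≤ ENNReal.ofReal (ε / 2) := by
    rw [measure_sdiff hKU hK.measurableSet.nullMeasurableSet hK.measure_lt_top.ne]
    exact tsub_le_iff_left.2 hUK.le
  have m1 : MeasurableSet (A \ K) := hm.diff hK.measurableSet
  have m2 : MeasurableSet (U \ K) := hU.measurableSet.diff hK.measurableSet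
  have f1 : volume (A \ K) < ⊤ := hAK.trans ENNReal.ofReal_lt_top
  have f2 : volume (U \ K) < ⊤ := hUm.trans_lt ENNReal.ofReal_lt_top
  calc ∫ x, |A.indicator 1 x - φ x|
      ≤ ∫ x, ((A \ K).indicator 1 x + (U \ K).indicator 1 x) := by
        refine integral_mono_of_nonneg (Filter.Eventually.of_forall fun x => abs_nonneg _)
          ((integrable_indicator_one m1.nullMeasurableSet f1).add
            (integrable_indicator_one m2.nullMeasurableSet f2))
          (Filter.Eventually.of_forall fun x => ?_)
        have hx := hφ01 x
        by_cases hxK : x ∈ K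
        · have : φ x = 1 := (h4 x).1 hxK
          simp [this, hKA hxK, hxK]
        · by_cases hxA : x ∈ A
          · have : 0 ≤ (U \ K).indicator (1 : Euc d → ℝ) x :=
              Set.indicator_nonneg (fun _ _ => zero_le_one) x
            simp only [hxA, Set.indicator_of_mem, Pi.one_apply, Set.mem_sdiff, hxK,
              not_false_eq_true, and_self]
            rw [abs_le]
            constructor <;> linarith
          · by_cases hxU : x ∈ U
            · simp [hxA, hxU, hxK, abs_le]
              constructor <;> linarith
            · have : φ x = 0 := by
                rw [← Function.notMem_support, h3]
                exact fun h => hxU h.1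
              simp [hxA, hxU, this]
    _ = volume.real (A \ K) + volume.real (U \ K) := by
        rw [integral_add (integrable_indicator_one m1.nullMeasurableSet f1)
            (integrable_indicator_one m2.nullMeasurableSet f2),
          integral_indicator_one_eq m1.nullMeasurableSet,
          integral_indicator_one_eq m2.nullMeasurableSet]
    _ ≤ ε / 2 + ε / 2 := by
        gcongr
        · exact ENNReal.toReal_le_of_le_ofReal (by positivity) hAK.le
        · exact ENNReal.toReal_le_of_le_ofReal (by positivity) hUm
    _ = ε := by ring

/-- The left side is the measure of the part of A that translation by y carries out of A. A test
function close to the indicator in L¹ reduces the bound to `abs_setIntegral_sub_translate_le`, with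
an error ε/2 from each of the two integrals. -/
lemma measureReal_sub_overlap_le {A : Set (Euc d)} (hA : NullMeasurableSet A volume)
    (hA' : volume A < ⊤) (hP : perimeter A < ⊤) (y : Euc d) :
    volume.real A - ∫ x, A.indicator (1 : Euc d → ℝ) x * A.indicator 1 (x + y) ≤
      ‖y‖ * (perimeter A).toReal := by
  refine le_of_forall_pos_le_add fun ε hε => ?_
  obtain ⟨φ, h1, h2, h3, h4⟩ := exists_test_integral_indicator_sub_le hA hA' (half_pos hε)
  have hφi : Integrable φ := h1.continuous.integrable_of_hasCompactSupport h2
  have hi := integrable_indicator_one hA hA'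
  have key := (abs_le.1 (abs_setIntegral_sub_translate_le hA hA' hP
    (h1.of_le (by exact_mod_cast le_top)) h2
    (fun x => abs_le.2 ⟨by linarith [(h3 x).1], (h3 x).2⟩) (-y))).1
  simp only [sub_neg_eq_add, norm_neg] at key
  have hd : Integrable (fun x => |A.indicator 1 x - φ x|) := (hi.sub hφi).abs
  have e1 : volume.real A - ∫ x in A, φ x ≤ ε / 2 := by
    rw [← integral_indicator_one_eq hA, ← setIntegral_mul_eq_integral_indicator_mul hA]
    have hm : Integrable (fun x => A.indicator 1 x * φ x) := by
      refine hφi.bdd_mul (c := 1) hi.1 (Filter.Eventually.of_forall fun x => ?_)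
      by_cases hx : x ∈ A <;> simp [hx]
    rw [← integral_sub hi hm]
    refine (integral_mono (hi.sub hm) hd fun x => ?_).trans h4
    by_cases hx : x ∈ A
    · simpa [hx] using le_abs_self (1 - φ x)
    · simp [hx]
  have e2 : (∫ x in A, φ (x + y)) - ∫ x, A.indicator (1 : Euc d → ℝ) x * A.indicator 1 (x + y) ≤
      ε / 2 := by
    rw [setIntegral_mul_eq_integral_indicator_mul hA,
      ← integral_sub (hφi.comp_add_right y).integrableOn (hi.comp_add_right y).integrableOn]
    have hd' := hd.comp_add_right y
    calc _ ≤ ∫ x in A, |A.indicator 1 (x + y) - φ (x + y)| := by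
          refine integral_mono ((hφi.comp_add_right y).integrableOn.sub
            (hi.comp_add_right y).integrableOn) hd'.integrableOn fun x => ?_
          rw [abs_sub_comm]
          exact le_abs_self _
      _ ≤ ∫ x, |A.indicator 1 (x + y) - φ (x + y)| :=
          setIntegral_le_integral hd' (Filter.Eventually.of_forall fun x => abs_nonneg _)
      _ ≤ _ := by
          rwa [integral_add_right_eq_self (fun x => |A.indicator 1 x - φ x|) y]
  linarith

/-- Isoperimetric inequality, with a non-optimal constant. -/
lemma measureReal_le_mul_perimeter {A : Set (Euc d)} (hA : NullMeasurableSet A volume)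
    (hA' : volume A < ⊤) (hP : perimeter A < ⊤) {r : ℝ} (hr : 0 < r)
    (hball : 2 * volume.real A ≤ volume.real (ball (0 : Euc d) r)) :
    volume.real A ≤ 2 * r * (perimeter A).toReal := by
  obtain ⟨y, hy, hle⟩ := exists_translate_integral_mul_le (integrable_indicator_one hA hA') hr
  have habs : ∀ x, |A.indicator (1 : Euc d → ℝ) x| = A.indicator 1 x := fun x =>
    abs_of_nonneg (Set.indicator_nonneg (fun _ _ => zero_le_one) x)
  simp only [habs] at hle
  rw [integral_indicator_one_eq hA] at hle
  have h1 := measureReal_sub_overlap_le hA hA' hP y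
  have hB : 0 < volume.real (ball (0 : Euc d) r) :=
    ENNReal.toReal_pos (measure_ball_pos _ _ hr).ne' measure_ball_lt_top.ne
  -- The averaged overlap is at most |A|²/|B_r| ≤ |A|/2, so at least half of A leaves A under the
  -- translation.
  have h2 : ∫ x, A.indicator (1 : Euc d → ℝ) x * A.indicator 1 (x + y) ≤ volume.real A / 2 := by
    have h0 : 0 ≤ volume.real A := measureReal_nonneg
    have : (∫ x, A.indicator (1 : Euc d → ℝ) x * A.indicator 1 (x + y)) *
        volume.real (ball (0 : Euc d) r) ≤
      (volume.real A / 2) * volume.real (ball (0 : Euc d) r) := by nlinarith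
    exact le_of_mul_le_mul_right this hB
  have h3 : ‖y‖ * (perimeter A).toReal ≤ r * (perimeter A).toReal := by
    have : ‖y‖ < r := by simpa using hy
    gcongr
  linarith

end Perimeter

/-! ### Vanishing of the weak gradient outside a set of finite perimeter. -/

section GradientVanishing

variable {d : ℕ}

lemma memLp_inner_const {g : Euc d → Euc d} (hg : MemLp g 2 volume) (y : Euc d) :
    MemLp (fun x => inner ℝ (g x) y) 2 volume := by
  refine (hg.norm.const_mul ‖y‖).of_le (hg.1.inner_const) (Filter.Eventually.of_forall fun x => ?_)
  rw [norm_mul, norm_norm, norm_norm, mul_comm]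
  exact norm_inner_le_norm _ _

lemma memLp_indicator_one {K : Set (Euc d)} (hK : NullMeasurableSet K volume)
    (hK' : volume K < ⊤) {p : ℝ≥0∞} : MemLp (K.indicator (1 : Euc d → ℝ)) p volume := by
  rw [memLp_congr_ae (indicator_ae_eq_of_ae_eq_set hK.toMeasurable_ae_eq).symm]
  refine memLp_indicator_const p (measurableSet_toMeasurable _ _) (1 : ℝ) (Or.inr ?_)
  rw [measure_toMeasurable]
  exact hK'.ne

/-- The difference quotients of `u` converge weakly to the directional derivative. -/
lemma IsH1With.hasDerivAt_integral_translate_mul {u : Euc d → ℝ} {g : Euc d → Euc d}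
    (h : IsH1With u g) {φ : Euc d → ℝ} (hφ : ContDiff ℝ ∞ φ) (hc : HasCompactSupport φ)
    (y : Euc d) :
    HasDerivAt (fun s : ℝ => ∫ x, (u (x + s • y) - u x) * φ x) (∫ x, inner ℝ (g x) y * φ x) 0 := by
  have hφ2 : MemLp φ 2 volume := memLp_two_of_test hφ.continuous hc
  have h1 := hasDerivAt_integral_mul_translate (h.memLp.locallyIntegrable (by norm_num))
      (hφ.of_le (by exact_mod_cast le_top)) hc y 0
  simp only [zero_smul, sub_zero] at h1
  rw [h.integral_by_parts φ hφ hc y, neg_neg] at h1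
  refine (h1.sub_const (∫ x, u x * φ x)).congr_of_eventuallyEq
    (Filter.Eventually.of_forall fun s => ?_)
  have i1 : Integrable (fun x => u (x + s • y) * φ x) :=
    (memLp_translate h.memLp (s • y)).integrable_mul hφ2
  have i2 : Integrable (fun x => u x * φ x) := h.memLp.integrable_mul hφ2
  simp only [sub_mul]
  rw [integral_sub i1 i2, ← integral_sub_right_eq_self (fun x => u (x + s • y) * φ x) (s • y)]
  simp

/-- On K the function vanishes almost everywhere, so the increment lives on K ∩ (A - z), inside (A -
z) \ A. That set has measure at most ‖z‖ P(A), and Cauchy–Schwarz gains the extra factor √‖z‖ which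
makes difference quotients on K tend to zero. -/
lemma IsSobolevLike.abs_integral_translate_sub_mul_indicator_le {A K : Set (Euc d)}
    (hA : NullMeasurableSet A volume) (hA' : volume A < ⊤) (hP : perimeter A < ⊤)
    {u : Euc d → ℝ} {g : Euc d → Euc d} (h : IsSobolevLike A u g)
    (hK : NullMeasurableSet K volume) (hK' : volume K < ⊤) (hKA : ∀ x ∈ K, x ∉ A) (z : Euc d) :
    |∫ x, (u (x + z) - u x) * K.indicator 1 x| ≤
      ‖z‖ * √(∫ x, ‖g x‖ ^ 2) * √(‖z‖ * (perimeter A).toReal) := by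
  have hu := h.isH1.memLp
  have huz := memLp_translate hu z
  set χ : Euc d → ℝ := fun x => K.indicator 1 x * A.indicator 1 (x + z) with hχ
  have hAz : MemLp (fun x => A.indicator (1 : Euc d → ℝ) (x + z)) 2 volume :=
    memLp_translate (memLp_indicator_one hA hA') z
  have hAz1 : Integrable (fun x => A.indicator (1 : Euc d → ℝ) (x + z)) :=
    (integrable_indicator_one hA hA').comp_add_right z
  have hχ2 : MemLp χ 2 volume := by
    refine hAz.of_le ((memLp_indicator_one hK hK' (p := 2)).1.mul hAz.1)
      (Filter.Eventually.of_forall fun x => ?_)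
    by_cases hx : x ∈ K <;> simp [hχ, hx]
  have e : ∫ x, (u (x + z) - u x) * K.indicator 1 x = ∫ x, (u (x + z) - u x) * χ x := by
    have h0 := h.ae_eq_zero
    have h0z : ∀ᵐ x, x + z ∉ A → u (x + z) = 0 :=
      (measurePreserving_add_right volume z).quasiMeasurePreserving.ae h0
    refine integral_congr_ae ?_
    filter_upwards [h0, h0z] with x hx hxz
    by_cases hxK : x ∈ K
    · by_cases hxA : x + z ∈ A
      · simp [hχ, hxK, hxA]
      · simp [hχ, hxK, hxA, hxz hxA, hx (hKA x hxK)]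
    · simp [hχ, hxK]
  rw [e]
  have hov : ∫ x, χ x ^ 2 ≤ ‖z‖ * (perimeter A).toReal := by
    refine le_trans ?_ (measureReal_sub_overlap_le hA hA' hP z)
    have i1 : Integrable (fun x => A.indicator (1 : Euc d → ℝ) x * A.indicator 1 (x + z)) :=
      (memLp_indicator_one hA hA' (p := 2)).integrable_mul hAz
    have e1 : volume.real A = ∫ x, A.indicator (1 : Euc d → ℝ) (x + z) := by
      rw [integral_add_right_eq_self (fun x => A.indicator (1 : Euc d → ℝ) x),
        integral_indicator_one_eq hA]
    rw [e1, ← integral_sub hAz1 i1]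
    refine integral_mono hχ2.integrable_sq (hAz1.sub i1) fun x => ?_
    by_cases hxK : x ∈ K
    · by_cases hxA : x + z ∈ A <;> simp [hχ, hxK, hxA, hKA x hxK]
    · by_cases hxA : x ∈ A
      · simp [hχ, hxK, hxA]
      · by_cases hxA' : x + z ∈ A <;> simp [hχ, hxK, hxA, hxA']
  calc |∫ x, (u (x + z) - u x) * χ x|
      ≤ √(∫ x, (u (x + z) - u x) ^ 2) * √(∫ x, χ x ^ 2) := abs_integral_mul_le (huz.sub hu) hχ2
    _ ≤ _ := by
      gcongr
      exact h.isH1.sqrt_integral_translate_sub_sq_le z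

/-- Difference quotients converge weakly only against test functions, so the indicator of K is
replaced by a test function φ within ε in L². With φ fixed, s → 0 kills the contribution of K; the
replacement costs O(ε) uniformly in s because the quotients are bounded in L². Then ε → 0. -/
lemma IsSobolevLike.setIntegral_inner_eq_zero {A K : Set (Euc d)}
    (hA : NullMeasurableSet A volume) (hA' : volume A < ⊤) (hP : perimeter A < ⊤)
    {u : Euc d → ℝ} {g : Euc d → Euc d} (h : IsSobolevLike A u g)
    (hK : NullMeasurableSet K volume) (hK' : volume K < ⊤) (hKA : ∀ x ∈ K, x ∉ A) (y : Euc d) :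
    ∫ x in K, inner ℝ (g x) y = 0 := by
  have hu := h.isH1.memLp
  have hψ : MemLp (K.indicator (1 : Euc d → ℝ)) 2 volume := memLp_indicator_one hK hK'
  have hgy := memLp_inner_const h.isH1.memLp_grad y
  set G := √(∫ x, ‖g x‖ ^ 2)
  set N := √(∫ x, inner ℝ (g x) y ^ 2)
  have hbound : ∀ ε > 0, |∫ x in K, inner ℝ (g x) y| ≤ (‖y‖ * G + N) * ε := by
    intro ε hε
    obtain ⟨φ, hφ, hc, hφε⟩ := exists_test_integral_sub_sq_lt hψ hε
    have hφ2 : MemLp φ 2 volume := memLp_two_of_test hφ.continuous hc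
    have hsub : MemLp (fun x => K.indicator 1 x - φ x) 2 volume := hψ.sub hφ2
    have hlim := (h.isH1.hasDerivAt_integral_translate_mul hφ hc y).tendsto_slope_zero_right
    have hlim2 : Filter.Tendsto (fun s : ℝ => ‖y‖ * G * ε +
        ‖y‖ * G * √(s * ‖y‖ * (perimeter A).toReal)) (nhdsWithin 0 (Set.Ioi 0))
        (nhds (‖y‖ * G * ε)) := by
      have : Continuous (fun s : ℝ => ‖y‖ * G * ε +
        ‖y‖ * G * √(s * ‖y‖ * (perimeter A).toReal)) := by fun_prop
      have := (this.tendsto 0).mono_left (nhdsWithin_le_nhds (s := Set.Ioi 0))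
      simpa using this
    have hle : |∫ x, inner ℝ (g x) y * φ x| ≤ ‖y‖ * G * ε := by
      refine le_of_tendsto_of_tendsto hlim.abs hlim2 ?_
      filter_upwards [self_mem_nhdsWithin] with s hs
      have hs : 0 < s := hs
      have hD : MemLp (fun x => u (x + s • y) - u x) 2 volume := (memLp_translate hu _).sub hu
      have i1 : Integrable (fun x => (u (x + s • y) - u x) * K.indicator 1 x) :=
        hD.integrable_mul hψ
      have i2 : Integrable (fun x => (u (x + s • y) - u x) * (K.indicator 1 x - φ x)) :=
        hD.integrable_mul hsub
      have e : ∫ x, (u (x + s • y) - u x) * φ x =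
          (∫ x, (u (x + s • y) - u x) * K.indicator 1 x) -
            ∫ x, (u (x + s • y) - u x) * (K.indicator 1 x - φ x) := by
        rw [← integral_sub i1 i2]
        congr 1
        ext x
        ring
      have b1 := h.abs_integral_translate_sub_mul_indicator_le hA hA' hP hK hK' hKA (s • y)
      have b2 := abs_integral_mul_le hD hsub
      have b3 := h.isH1.sqrt_integral_translate_sub_sq_le (s • y)
      rw [norm_smul, Real.norm_of_nonneg hs.le] at b1 b3
      have b4 : |∫ x, (u (x + s • y) - u x) * (K.indicator 1 x - φ x)| ≤ s * ‖y‖ * G * ε :=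
        b2.trans (by gcongr)
      simp only [zero_add, zero_smul, add_zero, sub_self, zero_mul, integral_zero, sub_zero,
        smul_eq_mul]
      rw [abs_mul, abs_inv, abs_of_pos hs, inv_mul_le_iff₀ hs, e]
      refine (abs_sub _ _).trans ?_
      refine (add_le_add b1 b4).trans (le_of_eq ?_)
      ring
    have e : ∫ x in K, inner ℝ (g x) y = (∫ x, inner ℝ (g x) y * φ x) +
        ∫ x, inner ℝ (g x) y * (K.indicator 1 x - φ x) := by
      have i1 : Integrable (fun x => inner ℝ (g x) y * φ x) := hgy.integrable_mul hφ2
      have i2 : Integrable (fun x => inner ℝ (g x) y * (K.indicator 1 x - φ x)) :=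
        hgy.integrable_mul hsub
      rw [← integral_add i1 i2, ← setIntegral_mul_eq_integral_indicator_mul hK]
      congr 1
      ext x
      ring
    rw [e]
    calc _ ≤ ‖y‖ * G * ε + N * ε := by
          refine (abs_add_le _ _).trans (add_le_add hle ?_)
          refine (abs_integral_mul_le hgy hsub).trans ?_
          gcongr
      _ = _ := by ring
  rw [← abs_nonpos_iff]
  refine le_of_forall_pos_le_add fun ε hε => ?_
  have hpos : 0 < ‖y‖ * G + N + 1 := by positivity
  have := hbound (ε / (‖y‖ * G + N + 1)) (by positivity)
  refine this.trans ?_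
  rw [zero_add, mul_div_assoc', div_le_iff₀ hpos]
  nlinarith

/-- The weak gradient vanishes almost everywhere outside a set of finite perimeter carrying the
function. -/
lemma IsSobolevLike.grad_ae_eq_zero {A : Set (Euc d)}
    (hA : NullMeasurableSet A volume) (hA' : volume A < ⊤) (hP : perimeter A < ⊤)
    {u : Euc d → ℝ} {g : Euc d → Euc d} (h : IsSobolevLike A u g) :
    ∀ᵐ x, x ∉ A → g x = 0 := by
  have key : ∀ y : Euc d, ∀ᵐ x, Aᶜ.indicator (fun x => inner ℝ (g x) y) x = 0 := by
    intro y
    have hl : LocallyIntegrable (Aᶜ.indicator (fun x => inner ℝ (g x) y)) volume := by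
      have hm := memLp_inner_const h.isH1.memLp_grad y
      refine MemLp.locallyIntegrable (p := 2) (hm.of_le (hm.1.indicator₀ hA.compl)
        (Filter.Eventually.of_forall fun x => ?_)) (by norm_num)
      exact norm_indicator_le_norm_self _ _
    refine ae_eq_zero_of_forall_setIntegral_isCompact_eq_zero' hl fun s hs => ?_
    rw [← integral_indicator hs.measurableSet, Set.indicator_indicator,
      integral_indicator₀ (hs.measurableSet.nullMeasurableSet.inter hA.compl)]
    refine h.setIntegral_inner_eq_zero hA hA' hP
      (hs.measurableSet.nullMeasurableSet.inter hA.compl)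
      ((measure_mono Set.inter_subset_left).trans_lt hs.measure_lt_top) (fun x hx => hx.2) y
  have hall : ∀ᵐ x, ∀ i : Fin d,
      Aᶜ.indicator (fun x => inner ℝ (g x) (EuclideanSpace.single i (1 : ℝ))) x = 0 :=
    ae_all_iff.2 fun i => key _
  filter_upwards [hall] with x hx hxA
  ext i
  have := hx i
  rw [Set.indicator_of_mem (show x ∈ Aᶜ from hxA), real_inner_comm,
    EuclideanSpace.inner_single_left] at this
  simpa using this

end GradientVanishing

/-! ### Linear structure of the Sobolev-like spaces and multiplication by smooth functions. -/

section Algebra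

variable {d : ℕ}

lemma integrable_mul_fderiv {u φ : Euc d → ℝ} (hu : MemLp u 2 volume) (hφ : ContDiff ℝ ∞ φ)
    (hc : HasCompactSupport φ) (v : Euc d) : Integrable (fun x => u x * fderiv ℝ φ x v) :=
  hu.integrable_mul (memLp_two_of_test
    ((hφ.continuous_fderiv (by simp)).clm_apply continuous_const) (hc.fderiv_apply ℝ v))

lemma integrable_inner_mul_test {g : Euc d → Euc d} {φ : Euc d → ℝ} (hg : MemLp g 2 volume)
    (hφ : Continuous φ) (hc : HasCompactSupport φ) (v : Euc d) :
    Integrable (fun x => inner ℝ (g x) v * φ x) :=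
  (memLp_inner_const hg v).integrable_mul (memLp_two_of_test hφ hc)

lemma IsH1With.add {u₁ u₂ : Euc d → ℝ} {g₁ g₂ : Euc d → Euc d} (h₁ : IsH1With u₁ g₁)
    (h₂ : IsH1With u₂ g₂) : IsH1With (u₁ + u₂) (g₁ + g₂) where
  memLp := h₁.memLp.add h₂.memLp
  memLp_grad := h₁.memLp_grad.add h₂.memLp_grad
  integral_by_parts φ hφ hc v := by
    simp only [Pi.add_apply, add_mul, inner_add_left]
    rw [integral_add (integrable_mul_fderiv h₁.memLp hφ hc v)
        (integrable_mul_fderiv h₂.memLp hφ hc v),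
      integral_add (integrable_inner_mul_test h₁.memLp_grad hφ.continuous hc v)
        (integrable_inner_mul_test h₂.memLp_grad hφ.continuous hc v),
      h₁.integral_by_parts φ hφ hc v, h₂.integral_by_parts φ hφ hc v]
    ring

lemma IsH1With.const_smul {u : Euc d → ℝ} {g : Euc d → Euc d} (h : IsH1With u g) (c : ℝ) :
    IsH1With (c • u) (c • g) where
  memLp := h.memLp.const_smul c
  memLp_grad := h.memLp_grad.const_smul c
  integral_by_parts φ hφ hc v := by
    simp only [Pi.smul_apply, smul_eq_mul, inner_smul_left, mul_assoc, integral_const_mul,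
      h.integral_by_parts φ hφ hc v]
    simp

lemma IsH1With.congr {u u' : Euc d → ℝ} {g g' : Euc d → Euc d} (h : IsH1With u g)
    (hu : u =ᵐ[volume] u') (hg : g =ᵐ[volume] g') : IsH1With u' g' where
  memLp := (memLp_congr_ae hu).1 h.memLp
  memLp_grad := (memLp_congr_ae hg).1 h.memLp_grad
  integral_by_parts φ hφ hc v := by
    rw [← integral_congr_ae (hu.mono fun x hx => by simp only [hx] :
        (fun x => u x * fderiv ℝ φ x v) =ᵐ[volume] fun x => u' x * fderiv ℝ φ x v),
      h.integral_by_parts φ hφ hc v,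
      integral_congr_ae (hg.mono fun x hx => by simp only [hx] :
        (fun x => inner ℝ (g x) v * φ x) =ᵐ[volume] fun x => inner ℝ (g' x) v * φ x)]

lemma IsSobolevLike.add {A : Set (Euc d)} {u₁ u₂ : Euc d → ℝ} {g₁ g₂ : Euc d → Euc d}
    (h₁ : IsSobolevLike A u₁ g₁) (h₂ : IsSobolevLike A u₂ g₂) :
    IsSobolevLike A (u₁ + u₂) (g₁ + g₂) where
  isH1 := h₁.isH1.add h₂.isH1
  ae_eq_zero := by
    filter_upwards [h₁.ae_eq_zero, h₂.ae_eq_zero] with x h1 h2 hx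
    simp [h1 hx, h2 hx]

lemma IsSobolevLike.const_smul {A : Set (Euc d)} {u : Euc d → ℝ} {g : Euc d → Euc d}
    (h : IsSobolevLike A u g) (c : ℝ) : IsSobolevLike A (c • u) (c • g) where
  isH1 := h.isH1.const_smul c
  ae_eq_zero := by
    filter_upwards [h.ae_eq_zero] with x h1 hx
    simp [h1 hx]

lemma IsSobolevLike.sub {A : Set (Euc d)} {u₁ u₂ : Euc d → ℝ} {g₁ g₂ : Euc d → Euc d}
    (h₁ : IsSobolevLike A u₁ g₁) (h₂ : IsSobolevLike A u₂ g₂) :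
    IsSobolevLike A (u₁ - u₂) (g₁ - g₂) := by
  have := h₁.add (h₂.const_smul (-1))
  simpa only [neg_smul, one_smul, ← sub_eq_add_neg] using this

lemma IsSobolevLike.zero (A : Set (Euc d)) : IsSobolevLike A 0 0 where
  isH1 := ⟨MemLp.zero, MemLp.zero, fun φ _ _ v => by simp⟩
  ae_eq_zero := by simp

lemma IsSobolevLike.congr {A : Set (Euc d)} {u u' : Euc d → ℝ} {g g' : Euc d → Euc d}
    (h : IsSobolevLike A u g) (hu : u =ᵐ[volume] u') (hg : g =ᵐ[volume] g') :
    IsSobolevLike A u' g' where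
  isH1 := h.isH1.congr hu hg
  ae_eq_zero := by
    filter_upwards [h.ae_eq_zero, hu] with x h1 h2 hx
    rw [← h2, h1 hx]

lemma IsSobolevLike.mono {A B : Set (Euc d)} (hAB : A ⊆ B) {u : Euc d → ℝ} {g : Euc d → Euc d}
    (h : IsSobolevLike A u g) : IsSobolevLike B u g where
  isH1 := h.isH1
  ae_eq_zero := h.ae_eq_zero.mono fun _ hx hxB => hx fun hxA => hxB (hAB hxA)

lemma memLp_mul_of_bound {η u : Euc d → ℝ} (hη : Continuous η) {C : ℝ} (hC : ∀ x, |η x| ≤ C)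
    (hu : MemLp u 2 volume) : MemLp (fun x => η x * u x) 2 volume := by
  refine MemLp.of_le (hu.const_mul C) (hη.aestronglyMeasurable.mul hu.1)
    (Filter.Eventually.of_forall fun x => ?_)
  rw [norm_mul, norm_mul]
  gcongr
  exact (hC x).trans (le_abs_self C)

lemma memLp_smul_of_bound {E : Type*} [NormedAddCommGroup E] [NormedSpace ℝ E] {η : Euc d → ℝ}
    {g : Euc d → E} (hη : Continuous η) {C : ℝ}
    (hC : ∀ x, |η x| ≤ C) (hg : MemLp g 2 volume) : MemLp (fun x => η x • g x) 2 volume := by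
  refine MemLp.of_le (hg.norm.const_mul C) (hη.aestronglyMeasurable.smul hg.1)
    (Filter.Eventually.of_forall fun x => ?_)
  rw [norm_smul, norm_mul, norm_norm]
  gcongr
  exact (hC x).trans (le_abs_self C)

lemma memLp_smul_field_of_bound {u : Euc d → ℝ} {γ : Euc d → Euc d} (hγ : Continuous γ) {C : ℝ}
    (hC : ∀ x, ‖γ x‖ ≤ C) (hu : MemLp u 2 volume) : MemLp (fun x => u x • γ x) 2 volume := by
  refine MemLp.of_le (hu.norm.const_mul C) (hu.1.smul hγ.aestronglyMeasurable)
    (Filter.Eventually.of_forall fun x => ?_)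
  rw [norm_smul, norm_mul, norm_norm, mul_comm]
  gcongr
  exact (hC x).trans (le_abs_self C)

/-- Multiplication by a smooth bounded function `η` with bounded gradient `γ`. -/
lemma IsH1With.mul_smooth {u : Euc d → ℝ} {g : Euc d → Euc d} (h : IsH1With u g)
    {η : Euc d → ℝ} {γ : Euc d → Euc d} (hη : ContDiff ℝ ∞ η) (hγ : Continuous γ)
    (hηγ : ∀ x v, fderiv ℝ η x v = inner ℝ (γ x) v) {C : ℝ} (hC : ∀ x, |η x| ≤ C)
    {C' : ℝ} (hC' : ∀ x, ‖γ x‖ ≤ C') :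
    IsH1With (fun x => η x * u x) (fun x => η x • g x + u x • γ x) where
  memLp := memLp_mul_of_bound hη.continuous hC h.memLp
  memLp_grad := (memLp_smul_of_bound hη.continuous hC h.memLp_grad).add
    (memLp_smul_field_of_bound hγ hC' h.memLp)
  integral_by_parts φ hφ hc v := by
    -- The product rule for the weak gradient is the integration by parts of `u` tested with η φ.
    have hηφ : ContDiff ℝ ∞ (fun x => η x * φ x) := hη.mul hφ
    have hηφc : HasCompactSupport (fun x => η x * φ x) := hc.mul_left
    have key := h.integral_by_parts _ hηφ hηφc v
    have hfd : ∀ x, fderiv ℝ (fun x => η x * φ x) x v =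
        η x * fderiv ℝ φ x v + inner ℝ (γ x) v * φ x := by
      intro x
      have h1 : DifferentiableAt ℝ η x := hη.differentiable (by simp) x
      have h2 : DifferentiableAt ℝ φ x := hφ.differentiable (by simp) x
      have h3 : HasFDerivAt (fun x => η x * φ x) (η x • fderiv ℝ φ x + φ x • fderiv ℝ η x) x :=
        h1.hasFDerivAt.mul h2.hasFDerivAt
      rw [h3.fderiv]
      simp [hηγ, mul_comm]
    have i1 : Integrable (fun x => η x * u x * fderiv ℝ φ x v) :=
      integrable_mul_fderiv (memLp_mul_of_bound hη.continuous hC h.memLp) hφ hc v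
    have i2 : Integrable (fun x => inner ℝ (u x • γ x) v * φ x) :=
      integrable_inner_mul_test (memLp_smul_field_of_bound hγ hC' h.memLp) hφ.continuous hc v
    have i3 : Integrable (fun x => inner ℝ (η x • g x) v * φ x) :=
      integrable_inner_mul_test (memLp_smul_of_bound hη.continuous hC h.memLp_grad)
        hφ.continuous hc v
    have e1 : ∫ x, u x * fderiv ℝ (fun x => η x * φ x) x v =
        (∫ x, η x * u x * fderiv ℝ φ x v) + ∫ x, inner ℝ (u x • γ x) v * φ x := by
      rw [← integral_add i1 i2]
      congr 1
      ext x
      rw [hfd, inner_smul_left]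
      simp
      ring
    have e2 : ∫ x, inner ℝ (g x) v * (η x * φ x) = ∫ x, inner ℝ (η x • g x) v * φ x := by
      congr 1
      ext x
      rw [inner_smul_left]
      simp
      ring
    simp only [inner_add_left, add_mul]
    rw [integral_add i3 i2]
    linarith

lemma IsSobolevLike.mul_smooth {A : Set (Euc d)} {u : Euc d → ℝ} {g : Euc d → Euc d}
    (h : IsSobolevLike A u g)
    {η : Euc d → ℝ} {γ : Euc d → Euc d} (hη : ContDiff ℝ ∞ η) (hγ : Continuous γ)
    (hηγ : ∀ x v, fderiv ℝ η x v = inner ℝ (γ x) v) {C : ℝ} (hC : ∀ x, |η x| ≤ C)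
    {C' : ℝ} (hC' : ∀ x, ‖γ x‖ ≤ C') :
    IsSobolevLike A (fun x => η x * u x) (fun x => η x • g x + u x • γ x) where
  isH1 := h.isH1.mul_smooth hη hγ hηγ hC hC'
  ae_eq_zero := h.ae_eq_zero.mono fun x hx hxA => by rw [hx hxA, mul_zero]

end Algebra

/-! ### Existence of the torsion function. -/

section LaxMilgram

variable {d : ℕ}

/-- Lax–Milgram for the form `⟪p.2, q.2⟫` on a closed subspace of a product on which a Poincaré
inequality holds. -/
lemma exists_forall_inner_snd_eq_inner_fst {H₁ H₂ : Type*} [NormedAddCommGroup H₁]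
    [InnerProductSpace ℝ H₁] [CompleteSpace H₁] [NormedAddCommGroup H₂] [InnerProductSpace ℝ H₂]
    [CompleteSpace H₂] (V : Submodule ℝ (WithLp 2 (H₁ × H₂)))
    (hcl : IsClosed (V : Set (WithLp 2 (H₁ × H₂)))) {C : ℝ} (hC : 0 ≤ C)
    (hpoin : ∀ p ∈ V, ‖p.fst‖ ^ 2 ≤ C * ‖p.snd‖ ^ 2) (χ : H₁) :
    ∃ w ∈ V, ∀ q ∈ V, inner ℝ w.snd q.snd = inner ℝ χ q.fst := by
  have : CompleteSpace V := hcl.completeSpace_coe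
  let π₁ : V →L[ℝ] H₁ := (WithLp.fstL 2 ℝ H₁ H₂).comp V.subtypeL
  let π₂ : V →L[ℝ] H₂ := (WithLp.sndL 2 ℝ H₁ H₂).comp V.subtypeL
  let B : V →L[ℝ] V →L[ℝ] ℝ := (innerSL ℝ).bilinearComp π₂ π₂
  have hB : ∀ p q : V, B p q = inner ℝ p.1.snd q.1.snd := fun p q => rfl
  -- The Poincaré bound gives ‖p‖² ≤ (C + 1) ‖p.snd‖², which is the source of the coercivity
  -- constant.
  have hco : IsCoercive B := by
    refine ⟨(C + 1)⁻¹, by positivity, fun p => ?_⟩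
    have e3 : ‖p‖ ^ 2 = ‖p.1.fst‖ ^ 2 + ‖p.1.snd‖ ^ 2 := WithLp.prod_norm_sq_eq_of_L2 p.1
    rw [hB, real_inner_self_eq_norm_sq, mul_assoc, ← sq, inv_mul_le_iff₀ (by positivity), e3]
    linarith [hpoin p.1 p.2]
  let f : V →L[ℝ] ℝ := (innerSL ℝ χ).comp π₁
  set F : V := (InnerProductSpace.toDual ℝ V).symm f with hF
  set w : V := hco.continuousLinearEquivOfBilin.symm F with hw
  refine ⟨w, w.2, fun q hq => ?_⟩
  have hsol : B w ⟨q, hq⟩ = f ⟨q, hq⟩ := by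
    rw [← hco.continuousLinearEquivOfBilin_apply, hw, ContinuousLinearEquiv.apply_symm_apply, hF,
      InnerProductSpace.toDual_symm_apply]
  exact hsol

lemma volume_real_ball (hd : 0 < d) {r : ℝ} (hr : 0 ≤ r) :
    volume.real (ball (0 : Euc d) r) = r ^ d * volume.real (ball (0 : Euc d) 1) := by
  have : Nonempty (Fin d) := ⟨⟨0, hd⟩⟩
  simp only [Measure.real]
  rw [Measure.addHaar_ball volume (0 : Euc d) hr, ENNReal.toReal_mul,
    ENNReal.toReal_ofReal (by positivity)]
  simp

lemma volume_real_ball_one_pos : 0 < volume.real (ball (0 : Euc d) 1) :=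
  ENNReal.toReal_pos (measure_ball_pos _ _ one_pos).ne' measure_ball_lt_top.ne

lemma exists_le_volume_real_ball (hd : 0 < d) (a : ℝ) :
    ∃ r : ℝ, 0 < r ∧ a ≤ volume.real (ball (0 : Euc d) r) := by
  have hω := volume_real_ball_one_pos (d := d)
  have h1 : (1 : ℝ) ≤ max 1 (a / volume.real (ball (0 : Euc d) 1)) := le_max_left _ _
  refine ⟨max 1 (a / volume.real (ball (0 : Euc d) 1)), by positivity, ?_⟩
  rw [volume_real_ball hd (by positivity), ← div_le_iff₀ hω]
  exact (le_max_right _ _).trans (le_self_pow₀ h1 hd.ne')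

/-- The pairs `(u, ∇u)` with `u` in the Sobolev-like space of `A`, as a subspace of `L² × L²`. -/
noncomputable def sobolevLikeSubmodule (A : Set (Euc d)) :
    Submodule ℝ (WithLp 2 (Lp ℝ 2 (volume : Measure (Euc d)) ×
      Lp (Euc d) 2 (volume : Measure (Euc d)))) where
  carrier := {p | IsSobolevLike A p.fst p.snd}
  zero_mem' := (IsSobolevLike.zero A).congr (Lp.coeFn_zero _ _ _).symm (Lp.coeFn_zero _ _ _).symm
  add_mem' hp hq := (IsSobolevLike.add hp hq).congr (Lp.coeFn_add _ _).symm
    (Lp.coeFn_add _ _).symm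
  smul_mem' c _ hp := (IsSobolevLike.const_smul hp c).congr (Lp.coeFn_smul _ _).symm
    (Lp.coeFn_smul _ _).symm

lemma mem_sobolevLikeSubmodule {A : Set (Euc d)} {p} :
    p ∈ sobolevLikeSubmodule A ↔ IsSobolevLike A p.fst p.snd := Iff.rfl

lemma isClosed_sobolevLikeSubmodule {A : Set (Euc d)} (hA : NullMeasurableSet A volume) :
    IsClosed (sobolevLikeSubmodule A : Set (WithLp 2 (Lp ℝ 2 (volume : Measure (Euc d)) ×
      Lp (Euc d) 2 (volume : Measure (Euc d))))) := by
  set 𝓛 := WithLp 2 (Lp ℝ 2 (volume : Measure (Euc d)) × Lp (Euc d) 2 (volume : Measure (Euc d)))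
  have hfst : Continuous (fun p : 𝓛 => p.fst) := (WithLp.fstL 2 ℝ _ _).continuous
  have hsnd : Continuous (fun p : 𝓛 => p.snd) := (WithLp.sndL 2 ℝ _ _).continuous
  have hmf : ∀ p : 𝓛, MemLp p.fst 2 volume := fun p => Lp.memLp _
  have hms : ∀ p : 𝓛, MemLp p.snd 2 volume := fun p => Lp.memLp _
  have c1 : ∀ f : Euc d → ℝ, MemLp f 2 volume →
      Continuous (fun p : 𝓛 => ∫ x, p.fst x * f x) := by
    intro f hf
    have : Continuous (fun p : 𝓛 => inner ℝ p.fst (hf.toLp f)) := hfst.inner continuous_const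
    convert this using 2 with p
    conv_rhs => rw [← Lp.toLp_coeFn p.fst (hmf p), inner_toLp_toLp]
    simp [mul_comm]
  have c2 : ∀ f : Euc d → Euc d, MemLp f 2 volume →
      Continuous (fun p : 𝓛 => ∫ x, inner ℝ (p.snd x) (f x)) := by
    intro f hf
    have : Continuous (fun p : 𝓛 => inner ℝ p.snd (hf.toLp f)) := hsnd.inner continuous_const
    convert this using 2 with p
    conv_rhs => rw [← Lp.toLp_coeFn p.snd (hms p), inner_toLp_toLp]
  have hind : ∀ p : 𝓛, MemLp (Aᶜ.indicator p.fst) 2 volume := fun p =>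
    (hmf p).of_le ((hmf p).1.indicator₀ hA.compl)
      (Filter.Eventually.of_forall fun x => norm_indicator_le_norm_self _ _)
  -- Membership is rewritten as the vanishing of continuous functionals. Being zero off A is tested
  -- against all q cut off to Aᶜ; the choice q = p recovers it, since then ∫_{Aᶜ} u² = 0.
  have hset : (sobolevLikeSubmodule A : Set 𝓛) =
      {p : 𝓛 | (∀ φ : Euc d → ℝ, ContDiff ℝ ∞ φ → HasCompactSupport φ → ∀ v : Euc d,
        ∫ x, p.fst x * fderiv ℝ φ x v = - ∫ x, inner ℝ (p.snd x) (φ x • v)) ∧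
        ∀ q : 𝓛, ∫ x, p.fst x * Aᶜ.indicator q.fst x = 0} := by
    ext p
    constructor
    · intro hp
      have hp : IsSobolevLike A p.fst p.snd := hp
      refine ⟨fun φ hφ hc v => ?_, fun q => ?_⟩
      · rw [hp.isH1.integral_by_parts φ hφ hc v]
        simp only [inner_smul_right, mul_comm]
      · refine integral_eq_zero_of_ae ?_
        filter_upwards [hp.ae_eq_zero] with x hx
        by_cases hxA : x ∈ A
        · simp [hxA]
        · simp [hx hxA]
    · rintro ⟨h1, h2⟩
      refine ⟨⟨hmf p, hms p, fun φ hφ hc v => ?_⟩, ?_⟩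
      · rw [h1 φ hφ hc v]
        simp only [inner_smul_right, mul_comm]
      · have h3 := h2 p
        have h4 : Integrable (fun x => p.fst x * Aᶜ.indicator p.fst x) :=
          (hmf p).integrable_mul (hind p)
        rw [integral_eq_zero_iff_of_nonneg (fun x => ?_) h4] at h3
        · filter_upwards [h3] with x hx hxA
          simpa [hxA] using hx
        · by_cases hxA : x ∈ A
          · simp [hxA]
          · simpa [hxA] using mul_self_nonneg _
  rw [hset]
  simp only [Set.ofPred_and, Set.ofPred_forall]
  refine IsClosed.inter ?_ ?_
  · refine isClosed_iInter fun φ => isClosed_iInter fun hφ => isClosed_iInter fun hc =>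
      isClosed_iInter fun v => isClosed_eq (c1 _ ?_) (c2 _ ?_).neg
    · exact memLp_two_of_test ((hφ.continuous_fderiv (by simp)).clm_apply continuous_const)
        (hc.fderiv_apply ℝ v)
    · exact (hφ.continuous.smul continuous_const).memLp_of_hasCompactSupport hc.smul_right
  · exact isClosed_iInter fun q => isClosed_eq (c1 _ (hind q)) continuous_const

lemma setIntegral_inner_eq_integral {A : Set (Euc d)} {g h : Euc d → Euc d}
    (hg : ∀ᵐ x, x ∉ A → g x = 0) : ∫ x in A, inner ℝ (g x) (h x) = ∫ x, inner ℝ (g x) (h x) :=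
  setIntegral_eq_integral_of_ae_compl_eq_zero (hg.mono fun x hx hxA => by simp [hx hxA])

lemma norm_fst_sq_le_of_mem_sobolevLikeSubmodule {A : Set (Euc d)} (hA' : volume A < ⊤) {r : ℝ}
    (hr : 0 < r) (hball : 2 * volume.real A ≤ volume.real (ball (0 : Euc d) r))
    {p : WithLp 2 (Lp ℝ 2 (volume : Measure (Euc d)) × Lp (Euc d) 2 (volume : Measure (Euc d)))}
    (hp : p ∈ sobolevLikeSubmodule A) : ‖p.fst‖ ^ 2 ≤ r ^ 2 * ‖p.snd‖ ^ 2 := by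
  have hpoin := IsSobolevLike.integral_sq_le hA' (mem_sobolevLikeSubmodule.1 hp) hr hball
  rw [← Lp.toLp_coeFn p.fst (Lp.memLp _), ← Lp.toLp_coeFn p.snd (Lp.memLp _), norm_toLp_sq,
    norm_toLp_sq]
  simpa using hpoin

/-- Existence of the torsion function. -/
theorem exists_isTorsionFunction (hd : 0 < d) {A : Set (Euc d)} (hA : NullMeasurableSet A volume)
    (hA' : volume A < ⊤) (hP : perimeter A < ⊤) : ∃ w, IsTorsionFunction A w := by
  obtain ⟨r, hr, hball⟩ := exists_le_volume_real_ball hd (2 * volume.real A)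
  have hχ : MemLp (A.indicator (1 : Euc d → ℝ)) 2 volume := memLp_indicator_one hA hA'
  obtain ⟨w, hw, hsol⟩ := exists_forall_inner_snd_eq_inner_fst (sobolevLikeSubmodule A)
    (isClosed_sobolevLikeSubmodule hA) (sq_nonneg r)
    (fun p hp => norm_fst_sq_le_of_mem_sobolevLikeSubmodule hA' hr hball hp) (hχ.toLp _)
  rw [mem_sobolevLikeSubmodule] at hw
  refine ⟨w.fst, w.snd, hw, fun v h hv => ?_⟩
  have hq := hsol (WithLp.toLp 2 (hv.isH1.memLp.toLp v, hv.isH1.memLp_grad.toLp h))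
    (mem_sobolevLikeSubmodule.2
      (hv.congr hv.isH1.memLp.coeFn_toLp.symm hv.isH1.memLp_grad.coeFn_toLp.symm))
  -- Lax–Milgram pairs gradients over the whole space, the weak equation over A; they agree because
  -- the gradient vanishes off A.
  rw [setIntegral_inner_eq_integral (hw.grad_ae_eq_zero hA hA' hP),
    ← setIntegral_mul_eq_integral_indicator_mul hA]
  have e1 : inner ℝ w.snd (hv.isH1.memLp_grad.toLp h) = ∫ x, inner ℝ (w.snd x) (h x) := by
    conv_lhs => rw [← Lp.toLp_coeFn w.snd (Lp.memLp _)]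
    exact inner_toLp_toLp (Lp.memLp _) hv.isH1.memLp_grad
  have e2 : inner ℝ (hχ.toLp _) (hv.isH1.memLp.toLp v) = ∫ x, A.indicator 1 x * v x := by
    refine (inner_toLp_toLp hχ hv.isH1.memLp).trans ?_
    simp [mul_comm]
  rw [← e1, ← e2]
  exact hq

end LaxMilgram

/-! ### Energy identities for the torsion function. -/

section Energy

variable {d : ℕ}

lemma setIntegral_norm_sq_eq_integral {A : Set (Euc d)} {g : Euc d → Euc d}
    (hg : ∀ᵐ x, x ∉ A → g x = 0) : ∫ x in A, ‖g x‖ ^ 2 = ∫ x, ‖g x‖ ^ 2 :=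
  setIntegral_eq_integral_of_ae_compl_eq_zero (hg.mono fun x hx hxA => by simp [hx hxA])

/-- `w`, with gradient `g`, is the torsion function of `Ω`. -/
structure IsTorsionPair (Ω : Set (Euc d)) (w : Euc d → ℝ) (g : Euc d → Euc d) : Prop where
  isSobolevLike : IsSobolevLike Ω w g
  weak_eq : ∀ (v : Euc d → ℝ) (h : Euc d → Euc d), IsSobolevLike Ω v h →
    ∫ x in Ω, inner ℝ (g x) (h x) = ∫ x in Ω, v x

lemma IsTorsionPair.isTorsionFunction {Ω : Set (Euc d)} {w : Euc d → ℝ} {g : Euc d → Euc d}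
    (h : IsTorsionPair Ω w g) : IsTorsionFunction Ω w := ⟨g, h.1, h.2⟩

lemma exists_isTorsionPair (hd : 0 < d) {A : Set (Euc d)} (hA : NullMeasurableSet A volume)
    (hA' : volume A < ⊤) (hP : perimeter A < ⊤) : ∃ w g, IsTorsionPair A w g := by
  obtain ⟨w, g, h1, h2⟩ := exists_isTorsionFunction hd hA hA' hP
  exact ⟨w, g, h1, h2⟩

lemma IsTorsionPair.integral_norm_sq {Ω : Set (Euc d)} {w : Euc d → ℝ} {g : Euc d → Euc d}
    (h : IsTorsionPair Ω w g) : ∫ x in Ω, ‖g x‖ ^ 2 = ∫ x in Ω, w x := by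
  simpa using h.weak_eq w g h.isSobolevLike

/-- The functional is quadratic and the weak equation cancels the linear term at its minimiser. This
identity gives minimality and also turns an energy gap into a gradient distance. -/
lemma IsTorsionPair.torsionFunctional_eq {Ω : Set (Euc d)} {w v : Euc d → ℝ}
    {g h : Euc d → Euc d} (hw : IsTorsionPair Ω w g) (hv : IsSobolevLike Ω v h) :
    torsionFunctional Ω v h = torsionFunctional Ω w g + (1 / 2) * ∫ x in Ω, ‖h x - g x‖ ^ 2 := by
  have hg := hw.isSobolevLike.isH1.memLp_grad.restrict Ω
  have hh := hv.isH1.memLp_grad.restrict Ω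
  have i1 := integrable_norm_sq_of_memLp hg
  have i2 := integrable_norm_sq_of_memLp hh
  have i3 : Integrable (fun x => inner ℝ (g x) (h x)) (volume.restrict Ω) :=
    integrable_inner_of_memLp hg hh
  have i4 : Integrable (fun x => ‖g x‖ ^ 2 - 2 * inner ℝ (g x) (h x)) (volume.restrict Ω) :=
    i1.sub (i3.const_mul 2)
  have e : ∀ x, ‖h x - g x‖ ^ 2 = ‖h x‖ ^ 2 + (‖g x‖ ^ 2 - 2 * inner ℝ (g x) (h x)) := by
    intro x
    rw [norm_sub_sq_real, real_inner_comm]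
    ring
  simp only [torsionFunctional, e]
  rw [integral_add i2 i4, integral_sub i1 (i3.const_mul 2), integral_const_mul,
    hw.weak_eq v h hv, hw.integral_norm_sq]
  ring

/-- A real `sInf` takes a default value on sets unbounded below; attainment of the minimum makes
`energy` the actual minimum. -/
lemma IsTorsionPair.isLeast {Ω : Set (Euc d)} {w : Euc d → ℝ} {g : Euc d → Euc d}
    (hw : IsTorsionPair Ω w g) :
    IsLeast {e : ℝ | ∃ (w : Euc d → ℝ) (g : Euc d → Euc d),
      IsSobolevLike Ω w g ∧ e = torsionFunctional Ω w g} (torsionFunctional Ω w g) := by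
  refine ⟨⟨w, g, hw.isSobolevLike, rfl⟩, ?_⟩
  rintro _ ⟨v, h, hv, rfl⟩
  rw [hw.torsionFunctional_eq hv]
  have : 0 ≤ ∫ x in Ω, ‖h x - g x‖ ^ 2 := by positivity
  linarith

lemma IsTorsionPair.energy_eq {Ω : Set (Euc d)} {w : Euc d → ℝ} {g : Euc d → Euc d}
    (hw : IsTorsionPair Ω w g) : energy Ω = torsionFunctional Ω w g :=
  hw.isLeast.csInf_eq

lemma IsTorsionPair.energy_le {Ω : Set (Euc d)} {w v : Euc d → ℝ} {g h : Euc d → Euc d}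
    (hw : IsTorsionPair Ω w g) (hv : IsSobolevLike Ω v h) :
    energy Ω ≤ torsionFunctional Ω v h := by
  rw [hw.energy_eq]
  exact hw.isLeast.2 ⟨v, h, hv, rfl⟩

/-- Caccioppoli identity. -/
lemma IsTorsionPair.integral_norm_grad_mul_sq {Ω : Set (Euc d)} {w : Euc d → ℝ}
    {g : Euc d → Euc d} (hw : IsTorsionPair Ω w g)
    {η : Euc d → ℝ} {γ : Euc d → Euc d} (hη : ContDiff ℝ ∞ η) (hγ : Continuous γ)
    (hηγ : ∀ x v, fderiv ℝ η x v = inner ℝ (γ x) v) {C : ℝ} (hC : ∀ x, |η x| ≤ C)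
    {C' : ℝ} (hC' : ∀ x, ‖γ x‖ ≤ C') :
    ∫ x in Ω, ‖η x • g x + w x • γ x‖ ^ 2 =
      (∫ x in Ω, η x ^ 2 * w x) + ∫ x in Ω, w x ^ 2 * ‖γ x‖ ^ 2 := by
  -- The equation is tested with η² w, obtained by multiplying by η twice.
  have h1 := hw.isSobolevLike.mul_smooth hη hγ hηγ hC hC'
  have h2 := h1.mul_smooth hη hγ hηγ hC hC'
  have h3 := hw.weak_eq _ _ h2
  have i1 : Integrable (fun x => ‖w x • γ x‖ ^ 2) (volume.restrict Ω) :=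
    integrable_norm_sq_of_memLp
      ((memLp_smul_field_of_bound hγ hC' hw.isSobolevLike.isH1.memLp).restrict Ω)
  have i2 : Integrable (fun x => inner ℝ (g x)
      (η x • (η x • g x + w x • γ x) + (η x * w x) • γ x)) (volume.restrict Ω) :=
    integrable_inner_of_memLp (hw.isSobolevLike.isH1.memLp_grad.restrict Ω)
      (h2.isH1.memLp_grad.restrict Ω)
  have e : ∀ x, ‖η x • g x + w x • γ x‖ ^ 2 = inner ℝ (g x)
      (η x • (η x • g x + w x • γ x) + (η x * w x) • γ x) + ‖w x • γ x‖ ^ 2 := by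
    intro x
    rw [norm_add_sq_real]
    simp only [norm_smul, inner_add_right, inner_smul_right, inner_smul_left, mul_pow,
      real_inner_self_eq_norm_sq, Real.norm_eq_abs, sq_abs]
    simp
    ring
  simp only [e]
  rw [integral_add i2 i1, h3]
  simp only [norm_smul, mul_pow, Real.norm_eq_abs, sq_abs]
  congr 2
  ext x
  ring

/-- The Caccioppoli identity evaluates the Dirichlet term of η w, and the functional at w equals
-½∫w, so the terms in w combine to ½(1 - η)² w. -/
lemma IsTorsionPair.torsionFunctional_mul_sub {Ω : Set (Euc d)} (hΩ : volume Ω < ⊤)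
    {w : Euc d → ℝ} {g : Euc d → Euc d} (hw : IsTorsionPair Ω w g)
    {η : Euc d → ℝ} {γ : Euc d → Euc d} (hη : ContDiff ℝ ∞ η) (hγ : Continuous γ)
    (hηγ : ∀ x v, fderiv ℝ η x v = inner ℝ (γ x) v) {C : ℝ} (hC : ∀ x, |η x| ≤ C)
    {C' : ℝ} (hC' : ∀ x, ‖γ x‖ ≤ C') :
    torsionFunctional Ω (fun x => η x * w x) (fun x => η x • g x + w x • γ x) -
      torsionFunctional Ω w g =
      (1 / 2) * ∫ x in Ω, ((1 - η x) ^ 2 * w x + w x ^ 2 * ‖γ x‖ ^ 2) := by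
  have : IsFiniteMeasure (volume.restrict Ω) := ⟨by simpa using hΩ⟩
  have hw2 := hw.isSobolevLike.isH1.memLp
  have m1 := memLp_mul_of_bound hη.continuous hC hw2
  have m2 := memLp_mul_of_bound hη.continuous hC m1
  have i0 : Integrable w (volume.restrict Ω) := (hw2.restrict Ω).integrable (by norm_num)
  have i1 : Integrable (fun x => η x * w x) (volume.restrict Ω) :=
    (m1.restrict Ω).integrable (by norm_num)
  have i2 : Integrable (fun x => η x * (η x * w x)) (volume.restrict Ω) :=
    (m2.restrict Ω).integrable (by norm_num)
  have i3 : Integrable (fun x => w x ^ 2 * ‖γ x‖ ^ 2) (volume.restrict Ω) := by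
    have := integrable_norm_sq_of_memLp ((memLp_smul_field_of_bound hγ hC' hw2).restrict Ω)
    simpa [norm_smul, mul_pow] using this
  have e : ∀ x, (1 - η x) ^ 2 * w x = w x - 2 * (η x * w x) + η x * (η x * w x) := by
    intro x; ring
  have i4 : Integrable (fun x => (1 - η x) ^ 2 * w x) (volume.restrict Ω) := by
    simp only [e]
    exact (i0.sub (i1.const_mul 2)).add i2
  have i5 : Integrable (fun x => w x - 2 * (η x * w x)) (volume.restrict Ω) :=
    i0.sub (i1.const_mul 2)
  have e2 : ∫ x in Ω, (1 - η x) ^ 2 * w x =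
      (∫ x in Ω, w x) - 2 * (∫ x in Ω, η x * w x) + ∫ x in Ω, η x * (η x * w x) := by
    simp only [e]
    rw [integral_add i5 i2, integral_sub i0 (i1.const_mul 2), integral_const_mul]
  have e3 : ∫ x in Ω, η x ^ 2 * w x = ∫ x in Ω, η x * (η x * w x) := by
    congr 1; ext x; ring
  rw [integral_add i4 i3, e2]
  simp only [torsionFunctional]
  rw [hw.integral_norm_grad_mul_sq hη hγ hηγ hC hC', hw.integral_norm_sq, e3]
  ring

end Energy

/-! ### Smooth cut-offs along a direction. -/

section Cutoff

variable {d : ℕ}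

/-- Such points are global minima of the transition function; this covers the endpoint 0 as well. -/
lemma deriv_smoothTransition_of_nonpos {x : ℝ} (hx : x ≤ 0) :
    deriv Real.smoothTransition x = 0 := by
  refine IsLocalMin.deriv_eq_zero (Filter.Eventually.of_forall fun y => ?_)
  rw [Real.smoothTransition.zero_of_nonpos hx]
  exact Real.smoothTransition.nonneg y

lemma deriv_smoothTransition_of_one_le {x : ℝ} (hx : 1 ≤ x) :
    deriv Real.smoothTransition x = 0 := by
  refine IsLocalMax.deriv_eq_zero (Filter.Eventually.of_forall fun y => ?_)
  rw [Real.smoothTransition.one_of_one_le hx]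
  exact Real.smoothTransition.le_one y

lemma continuous_deriv_smoothTransition : Continuous (deriv Real.smoothTransition) :=
  (Real.smoothTransition.contDiff (n := 1)).continuous_deriv le_rfl

lemma exists_deriv_smoothTransition_bound : ∃ L : ℝ, ∀ x, |deriv Real.smoothTransition x| ≤ L := by
  obtain ⟨L, hL⟩ := isCompact_Icc.exists_bound_of_continuousOn (s := Set.Icc (0 : ℝ) 1)
    continuous_deriv_smoothTransition.continuousOn
  refine ⟨L, fun x => ?_⟩
  have h0 : 0 ≤ L := (norm_nonneg _).trans (hL 0 (by simp))
  rcases le_or_gt x 0 with hx | hx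
  · simpa [deriv_smoothTransition_of_nonpos hx] using h0
  rcases le_or_gt 1 x with hx' | hx'
  · simpa [deriv_smoothTransition_of_one_le hx'] using h0
  exact hL x ⟨hx.le, hx'.le⟩

/-- A Lipschitz constant of the smooth transition function. -/
noncomputable def transitionBound : ℝ := exists_deriv_smoothTransition_bound.choose

lemma abs_deriv_smoothTransition_le (x : ℝ) :
    |deriv Real.smoothTransition x| ≤ transitionBound :=
  exists_deriv_smoothTransition_bound.choose_spec x

lemma transitionBound_nonneg : 0 ≤ transitionBound :=
  (abs_nonneg _).trans (abs_deriv_smoothTransition_le 0)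

/-- A smooth function which is `0` where `⟪e, x⟫ ≤ a` and `1` where `⟪e, x⟫ ≥ a + δ`. -/
noncomputable def cutoff (e : Euc d) (a δ : ℝ) (x : Euc d) : ℝ :=
  Real.smoothTransition ((inner ℝ e x - a) / δ)

/-- The gradient of `cutoff`. -/
noncomputable def cutoffGrad (e : Euc d) (a δ : ℝ) (x : Euc d) : Euc d :=
  (deriv Real.smoothTransition ((inner ℝ e x - a) / δ) / δ) • e

/-- An open half space. -/
def halfSpace (e : Euc d) (t : ℝ) : Set (Euc d) := {x | t < inner ℝ e x}

lemma mem_halfSpace {e : Euc d} {t : ℝ} {x : Euc d} : x ∈ halfSpace e t ↔ t < inner ℝ e x := Iff.rfl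

lemma measurableSet_halfSpace (e : Euc d) (t : ℝ) : MeasurableSet (halfSpace e t) :=
  (isOpen_lt continuous_const (continuous_const.inner continuous_id)).measurableSet

lemma halfSpace_anti (e : Euc d) : Antitone (halfSpace e) := fun _ _ hst _ hx => hst.trans_lt hx

lemma contDiff_cutoff (e : Euc d) (a δ : ℝ) : ContDiff ℝ ∞ (cutoff e a δ) :=
  (Real.smoothTransition.contDiff (n := ⊤)).comp
    (((contDiff_const.inner ℝ contDiff_id).sub contDiff_const).div_const δ)

lemma continuous_cutoffGrad (e : Euc d) (a δ : ℝ) : Continuous (cutoffGrad e a δ) := by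
  unfold cutoffGrad
  exact ((continuous_deriv_smoothTransition.comp (by fun_prop)).div_const δ).smul continuous_const

lemma fderiv_cutoff (e : Euc d) (a δ : ℝ) (x v : Euc d) :
    fderiv ℝ (cutoff e a δ) x v = inner ℝ (cutoffGrad e a δ x) v := by
  have h1 : HasDerivAt Real.smoothTransition (deriv Real.smoothTransition ((inner ℝ e x - a) / δ))
      ((inner ℝ e x - a) / δ) :=
    ((Real.smoothTransition.contDiff (n := 1)).differentiable (by norm_num) _).hasDerivAt
  have h2 : HasFDerivAt (fun x : Euc d => (inner ℝ e x - a) / δ) (δ⁻¹ • innerSL ℝ e) x := by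
    have := (((innerSL ℝ e).hasFDerivAt (x := x)).sub_const a).const_mul δ⁻¹
    refine this.congr_of_eventuallyEq (Filter.Eventually.of_forall fun y => ?_)
    simp [div_eq_inv_mul]
  have h3 : HasFDerivAt (cutoff e a δ)
      (deriv Real.smoothTransition ((inner ℝ e x - a) / δ) • (δ⁻¹ • innerSL ℝ e)) x :=
    h1.comp_hasFDerivAt x h2
  rw [h3.fderiv]
  simp [cutoffGrad, inner_smul_left]
  ring

lemma cutoff_nonneg (e : Euc d) (a δ : ℝ) (x : Euc d) : 0 ≤ cutoff e a δ x :=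
  Real.smoothTransition.nonneg _

lemma cutoff_le_one (e : Euc d) (a δ : ℝ) (x : Euc d) : cutoff e a δ x ≤ 1 :=
  Real.smoothTransition.le_one _

lemma cutoff_eq_zero {e : Euc d} {a δ : ℝ} (hδ : 0 < δ) {x : Euc d} (hx : x ∉ halfSpace e a) :
    cutoff e a δ x = 0 := by
  rw [mem_halfSpace, not_lt] at hx
  exact Real.smoothTransition.zero_of_nonpos (div_nonpos_of_nonpos_of_nonneg (by linarith) hδ.le)

lemma cutoff_eq_one {e : Euc d} {a δ : ℝ} (hδ : 0 < δ) {x : Euc d} (hx : a + δ ≤ inner ℝ e x) :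
    cutoff e a δ x = 1 :=
  Real.smoothTransition.one_of_one_le ((one_le_div hδ).2 (by linarith))

lemma cutoffGrad_eq_zero {e : Euc d} {a δ : ℝ} (hδ : 0 < δ) {x : Euc d}
    (hx : x ∉ halfSpace e a) : cutoffGrad e a δ x = 0 := by
  rw [mem_halfSpace, not_lt] at hx
  rw [cutoffGrad, deriv_smoothTransition_of_nonpos
    (div_nonpos_of_nonpos_of_nonneg (by linarith) hδ.le)]
  simp

lemma cutoffGrad_eq_zero_of_mem {e : Euc d} {a δ : ℝ} (hδ : 0 < δ) {x : Euc d}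
    (hx : x ∈ halfSpace e (a + δ)) : cutoffGrad e a δ x = 0 := by
  rw [mem_halfSpace] at hx
  rw [cutoffGrad, deriv_smoothTransition_of_one_le ((one_le_div hδ).2 (by linarith))]
  simp

lemma norm_cutoffGrad_le {e : Euc d} (he : ‖e‖ ≤ 1) (a : ℝ) {δ : ℝ} (hδ : 0 < δ) (x : Euc d) :
    ‖cutoffGrad e a δ x‖ ≤ transitionBound / δ := by
  rw [cutoffGrad, norm_smul, norm_div, Real.norm_of_nonneg hδ.le, Real.norm_eq_abs]
  calc _ ≤ transitionBound / δ * 1 := by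
        gcongr
        · exact div_nonneg transitionBound_nonneg hδ.le
        · exact abs_deriv_smoothTransition_le _
    _ = _ := mul_one _

end Cutoff

/-! ### Tail mass, and energy estimates for cut domains. -/

section Decay

variable {d : ℕ}

/-- The constant in the Caccioppoli inequality for the cutoff functions. -/
noncomputable def cacc : ℝ := 1 + transitionBound ^ 2

lemma cacc_pos : 0 < cacc := by unfold cacc; positivity

/-- The mass of `1 + w²` in the part of `Ω` beyond a hyperplane. -/
noncomputable def tailMass (Ω : Set (Euc d)) (w : Euc d → ℝ) (e : Euc d) (t : ℝ) : ℝ :=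
  ∫ x in Ω ∩ halfSpace e t, (1 + w x ^ 2)

lemma integrableOn_one_add_sq {Ω : Set (Euc d)} (hΩ : volume Ω < ⊤) {w : Euc d → ℝ}
    (hw : MemLp w 2 volume) : IntegrableOn (fun x => 1 + w x ^ 2) Ω :=
  (integrableOn_const hΩ.ne).add hw.integrable_sq.integrableOn

lemma tailMass_eq_add {Ω : Set (Euc d)} (hΩ : volume Ω < ⊤) {w : Euc d → ℝ}
    (hw : MemLp w 2 volume) (e : Euc d) (t : ℝ) :
    tailMass Ω w e t = volume.real (Ω ∩ halfSpace e t) + ∫ x in Ω ∩ halfSpace e t, w x ^ 2 := by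
  have h : volume (Ω ∩ halfSpace e t) < ⊤ := (measure_mono Set.inter_subset_left).trans_lt hΩ
  have i1 : Integrable (fun _ : Euc d => (1 : ℝ)) (volume.restrict (Ω ∩ halfSpace e t)) :=
    integrableOn_const h.ne
  rw [tailMass, integral_add i1 hw.integrable_sq.integrableOn]
  simp

lemma measureReal_le_tailMass {Ω : Set (Euc d)} (hΩ : volume Ω < ⊤) {w : Euc d → ℝ}
    (hw : MemLp w 2 volume) (e : Euc d) (t : ℝ) :
    volume.real (Ω ∩ halfSpace e t) ≤ tailMass Ω w e t := by
  rw [tailMass_eq_add hΩ hw]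
  have : 0 ≤ ∫ x in Ω ∩ halfSpace e t, w x ^ 2 := by positivity
  linarith

lemma tailMass_nonneg (Ω : Set (Euc d)) (w : Euc d → ℝ) (e : Euc d) (t : ℝ) :
    0 ≤ tailMass Ω w e t := by unfold tailMass; positivity

lemma tailMass_anti {Ω : Set (Euc d)} (hΩ : volume Ω < ⊤) {w : Euc d → ℝ}
    (hw : MemLp w 2 volume) (e : Euc d) : Antitone (tailMass Ω w e) := by
  intro s t hst
  refine setIntegral_mono_set ((integrableOn_one_add_sq hΩ hw).mono_set Set.inter_subset_left)
    (Filter.Eventually.of_forall fun x => by simp; positivity)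
    (Set.inter_subset_inter_right _ (halfSpace_anti e hst)).eventuallyLE

lemma setIntegral_le_tailMass {Ω : Set (Euc d)} (hΩ : volume Ω < ⊤) {w : Euc d → ℝ}
    (hw : MemLp w 2 volume) (e : Euc d) (t : ℝ) {f : Euc d → ℝ} {c : ℝ} (hc : 0 ≤ c)
    (h0 : ∀ x, x ∉ halfSpace e t → f x ≤ 0) (h1 : ∀ x, f x ≤ c * (1 + w x ^ 2)) :
    ∫ x in Ω, f x ≤ c * tailMass Ω w e t := by
  have hi := (integrableOn_one_add_sq hΩ hw).const_mul c
  have hi' : IntegrableOn ((halfSpace e t).indicator fun x => c * (1 + w x ^ 2)) Ω :=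
    hi.indicator (measurableSet_halfSpace e t)
  rw [tailMass, ← integral_const_mul, ← setIntegral_indicator (measurableSet_halfSpace e t)]
  by_cases hf : IntegrableOn f Ω
  · refine integral_mono hf hi' fun x => ?_
    by_cases hx : x ∈ halfSpace e t
    · rw [Set.indicator_of_mem hx]; exact h1 x
    · rw [Set.indicator_of_notMem hx]; exact h0 x hx
  -- A non-integrable f has integral 0 by convention, so the bound holds without an integrability
  -- hypothesis.
  · rw [integral_undef hf]
    exact integral_nonneg fun x => Set.indicator_nonneg (fun x _ => by positivity) x

lemma tendsto_tailMass {Ω : Set (Euc d)} (hΩ : volume Ω < ⊤)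
    {w : Euc d → ℝ} (hw : MemLp w 2 volume) (e : Euc d) :
    Filter.Tendsto (tailMass Ω w e) Filter.atTop (nhds 0) := by
  have hi : Integrable (fun x => 1 + w x ^ 2) (volume.restrict Ω) := integrableOn_one_add_sq hΩ hw
  have h := tendsto_integral_filter_of_dominated_convergence (μ := volume.restrict Ω)
    (l := Filter.atTop) (f := fun _ => (0 : ℝ))
    (F := fun t : ℝ => (halfSpace e t).indicator fun x => 1 + w x ^ 2) (fun x => 1 + w x ^ 2)
    (Filter.Eventually.of_forall fun t => hi.1.indicator (measurableSet_halfSpace e t))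
    (Filter.Eventually.of_forall fun t => Filter.Eventually.of_forall fun x => by
      refine (norm_indicator_le_norm_self _ _).trans ?_
      rw [Real.norm_of_nonneg (by positivity)]) hi
    (Filter.Eventually.of_forall fun x => by
      refine tendsto_const_nhds.congr' ?_
      filter_upwards [Filter.eventually_ge_atTop (inner ℝ e x)] with t ht
      rw [Set.indicator_of_notMem]
      simpa [mem_halfSpace] using ht)
  simp only [setIntegral_indicator (measurableSet_halfSpace e _), integral_zero] at h
  exact h

lemma le_one_add_sq (a : ℝ) : a ≤ 1 + a ^ 2 := by nlinarith [sq_nonneg (a - 1 / 2)]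

/-- Pointwise bound of the Caccioppoli integrand for a value a of unknown sign: a ≤ 1 + a² handles
the source term, and δ ≤ 1 absorbs it into the scale δ⁻². -/
lemma sq_mul_add_le {a η γ δ : ℝ} (hη0 : 0 ≤ η) (hη1 : η ≤ 1) (hγ : |γ| ≤ transitionBound / δ)
    (hδ : 0 < δ) (hδ1 : δ ≤ 1) : η ^ 2 * a + a ^ 2 * γ ^ 2 ≤ cacc / δ ^ 2 * (1 + a ^ 2) := by
  have h1 : η ^ 2 * a ≤ 1 / δ ^ 2 * (1 + a ^ 2) := by
    have hη : η ^ 2 ≤ 1 := pow_le_one₀ hη0 hη1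
    have hδ2 : 1 ≤ 1 / δ ^ 2 := (one_le_div (by positivity)).2 (pow_le_one₀ hδ.le hδ1)
    have : η ^ 2 * a ≤ 1 + a ^ 2 := by
      rcases le_or_gt a 0 with ha | ha
      · nlinarith [sq_nonneg η, sq_nonneg a, mul_nonneg (sq_nonneg η) (neg_nonneg.2 ha)]
      · nlinarith [le_one_add_sq a]
    nlinarith [sq_nonneg a]
  have h2 : a ^ 2 * γ ^ 2 ≤ transitionBound ^ 2 / δ ^ 2 * (1 + a ^ 2) := by
    have : γ ^ 2 ≤ transitionBound ^ 2 / δ ^ 2 := by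
      rw [← div_pow, ← sq_abs γ]
      gcongr
    nlinarith [sq_nonneg a, sq_nonneg γ]
  calc _ ≤ _ := add_le_add h1 h2
    _ = _ := by unfold cacc; ring

/-- The competitor is (1 - `cutoff`) w. It differs from w only beyond height t, so the energy excess
is paid by the tail mass there. -/
lemma IsTorsionPair.torsionFunctional_cut_sub_le {Ω : Set (Euc d)} (hΩ : volume Ω < ⊤)
    {w : Euc d → ℝ} {g : Euc d → Euc d} (hw : IsTorsionPair Ω w g) {e : Euc d} (he : ‖e‖ ≤ 1)
    (t : ℝ) {δ : ℝ} (hδ : 0 < δ) (hδ1 : δ ≤ 1) :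
    ∃ v h, IsSobolevLike (Ω \ halfSpace e (t + δ)) v h ∧
      torsionFunctional Ω v h - torsionFunctional Ω w g ≤
        (1 / 2) * (cacc / δ ^ 2 * tailMass Ω w e t) := by
  set η : Euc d → ℝ := fun x => 1 - cutoff e t δ x with hη
  set γ : Euc d → Euc d := fun x => -cutoffGrad e t δ x with hγ
  have h1 : ContDiff ℝ ∞ η := contDiff_const.sub (contDiff_cutoff e t δ)
  have h2 : Continuous γ := (continuous_cutoffGrad e t δ).neg
  have h3 : ∀ x v, fderiv ℝ η x v = inner ℝ (γ x) v := by
    intro x v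
    simp only [hη, hγ, fderiv_const_sub, inner_neg_left, ← fderiv_cutoff]
    simp
  have h4 : ∀ x, |η x| ≤ 1 := fun x => by
    have := cutoff_nonneg e t δ x
    have := cutoff_le_one e t δ x
    rw [abs_le]
    constructor <;> simp only [hη] <;> linarith
  have h5 : ∀ x, ‖γ x‖ ≤ transitionBound / δ := fun x => by
    simp only [hγ, norm_neg]
    exact norm_cutoffGrad_le he t hδ x
  have hS := hw.isSobolevLike.mul_smooth h1 h2 h3 h4 h5
  refine ⟨_, _, ⟨hS.isH1, ?_⟩, ?_⟩
  · filter_upwards [hS.ae_eq_zero] with x hx hxU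
    by_cases hxΩ : x ∈ Ω
    · have : x ∈ halfSpace e (t + δ) := by
        by_contra hc
        exact hxU ⟨hxΩ, hc⟩
      simp [hη, cutoff_eq_one hδ (mem_halfSpace.1 this).le]
    · exact hx hxΩ
  · rw [hw.torsionFunctional_mul_sub hΩ h1 h2 h3 h4 h5]
    refine mul_le_mul_of_nonneg_left ?_ (by norm_num)
    refine setIntegral_le_tailMass hΩ hw.isSobolevLike.isH1.memLp e t
      (div_nonneg cacc_pos.le (by positivity)) (fun x hx => ?_) (fun x => ?_)
    · simp [hη, hγ, cutoff_eq_zero hδ hx, cutoffGrad_eq_zero hδ hx]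
    · refine sq_mul_add_le (δ := δ) ?_ ?_ ?_ hδ hδ1
      · simpa [hη] using cutoff_nonneg e t δ x
      · simpa [hη] using cutoff_le_one e t δ x
      · simpa using h5 x

/-- The product of `cutoff` and w lives in Ω ∩ H_t, of small volume, so the Poincaré inequality
applies at scale r, and the Caccioppoli identity bounds its gradient. Finite perimeter of Ω lets the
gradient be integrated over Ω only. -/
lemma IsTorsionPair.setIntegral_sq_le {Ω : Set (Euc d)} (hΩm : NullMeasurableSet Ω volume)
    (hΩ : volume Ω < ⊤) (hP : perimeter Ω < ⊤)
    {w : Euc d → ℝ} {g : Euc d → Euc d} (hw : IsTorsionPair Ω w g) {e : Euc d} (he : ‖e‖ ≤ 1)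
    (t : ℝ) {δ : ℝ} (hδ : 0 < δ) (hδ1 : δ ≤ 1) {r : ℝ} (hr : 0 < r)
    (hball : 2 * volume.real (Ω ∩ halfSpace e t) ≤ volume.real (ball (0 : Euc d) r)) :
    ∫ x in Ω ∩ halfSpace e (t + δ), w x ^ 2 ≤ r ^ 2 * (cacc / δ ^ 2 * tailMass Ω w e t) := by
  have h1 := contDiff_cutoff e t δ
  have h2 := continuous_cutoffGrad e t δ
  have h3 := fderiv_cutoff e t δ
  have h4 : ∀ x, |cutoff e t δ x| ≤ 1 := fun x => by
    rw [abs_of_nonneg (cutoff_nonneg e t δ x)]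
    exact cutoff_le_one e t δ x
  have h5 := norm_cutoffGrad_le he t hδ
  have hS := hw.isSobolevLike.mul_smooth h1 h2 h3 h4 h5
  have hS' : IsSobolevLike (Ω ∩ halfSpace e t) (fun x => cutoff e t δ x * w x)
      (fun x => cutoff e t δ x • g x + w x • cutoffGrad e t δ x) := by
    refine ⟨hS.isH1, ?_⟩
    filter_upwards [hS.ae_eq_zero] with x hx hxU
    by_cases hxΩ : x ∈ Ω
    · have : x ∉ halfSpace e t := fun hc => hxU ⟨hxΩ, hc⟩
      simp [cutoff_eq_zero hδ this]
    · exact hx hxΩ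
  have hpoin := hS'.integral_sq_le ((measure_mono Set.inter_subset_left).trans_lt hΩ) hr hball
  have hgrad : ∫ x, ‖cutoff e t δ x • g x + w x • cutoffGrad e t δ x‖ ^ 2 =
      ∫ x in Ω, ‖cutoff e t δ x • g x + w x • cutoffGrad e t δ x‖ ^ 2 :=
    (setIntegral_norm_sq_eq_integral (hS.grad_ae_eq_zero hΩm hΩ hP)).symm
  have hcacc : ∫ x in Ω, ‖cutoff e t δ x • g x + w x • cutoffGrad e t δ x‖ ^ 2 ≤
      cacc / δ ^ 2 * tailMass Ω w e t := by
    have : IsFiniteMeasure (volume.restrict Ω) := ⟨by simpa using hΩ⟩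
    have hw2 := hw.isSobolevLike.isH1.memLp
    have i2 : Integrable (fun x => cutoff e t δ x ^ 2 * w x) (volume.restrict Ω) := by
      have m2 := memLp_mul_of_bound h1.continuous h4 (memLp_mul_of_bound h1.continuous h4 hw2)
      refine ((m2.restrict Ω).integrable (by norm_num)).congr
        (Filter.Eventually.of_forall fun x => ?_)
      simp only; ring
    have i3 : Integrable (fun x => w x ^ 2 * ‖cutoffGrad e t δ x‖ ^ 2) (volume.restrict Ω) := by
      have := integrable_norm_sq_of_memLp ((memLp_smul_field_of_bound h2 h5 hw2).restrict Ω)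
      simpa [norm_smul, mul_pow] using this
    rw [hw.integral_norm_grad_mul_sq h1 h2 h3 h4 h5, ← integral_add i2 i3]
    refine setIntegral_le_tailMass hΩ hw2 e t
      (div_nonneg cacc_pos.le (by positivity)) (fun x hx => ?_) (fun x => ?_)
    · simp [cutoff_eq_zero hδ hx, cutoffGrad_eq_zero hδ hx]
    · refine sq_mul_add_le (cutoff_nonneg e t δ x) (cutoff_le_one e t δ x) ?_ hδ hδ1
      simpa using h5 x
  have hlow : ∫ x in Ω ∩ halfSpace e (t + δ), w x ^ 2 ≤ ∫ x, (cutoff e t δ x * w x) ^ 2 := by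
    have hi : Integrable (fun x => (cutoff e t δ x * w x) ^ 2) := hS.isH1.memLp.integrable_sq
    refine le_trans (le_of_eq ?_) (setIntegral_le_integral (s := Ω ∩ halfSpace e (t + δ)) hi
      (Filter.Eventually.of_forall fun x => sq_nonneg _))
    refine setIntegral_congr_ae₀ (hΩm.inter (measurableSet_halfSpace e _).nullMeasurableSet)
      (Filter.Eventually.of_forall fun x hx => ?_)
    simp only [cutoff_eq_one hδ (mem_halfSpace.1 hx.2).le, one_mul]
  rw [hgrad] at hpoin
  exact hlow.trans (hpoin.trans (by gcongr))

/-- A function of the Sobolev-like space of `U ⊆ Ω` has the same functional on `U` and on `Ω`. -/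
lemma IsSobolevLike.torsionFunctional_eq_of_subset {U Ω : Set (Euc d)}
    (hUΩ : U ⊆ Ω) (hU : NullMeasurableSet U volume) (hU' : volume U < ⊤) (hP : perimeter U < ⊤)
    {v : Euc d → ℝ} {h : Euc d → Euc d} (hv : IsSobolevLike U v h) :
    torsionFunctional Ω v h = torsionFunctional U v h := by
  have hg := hv.grad_ae_eq_zero hU hU' hP
  have hgΩ : ∀ᵐ x, x ∉ Ω → h x = 0 := hg.mono fun x hx hxΩ => hx fun hxU => hxΩ (hUΩ hxU)
  have hvΩ := (hv.mono hUΩ).ae_eq_zero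
  simp only [torsionFunctional]
  rw [setIntegral_norm_sq_eq_integral hgΩ, setIntegral_norm_sq_eq_integral hg,
    setIntegral_eq_integral_of_ae_compl_eq_zero hvΩ,
    setIntegral_eq_integral_of_ae_compl_eq_zero hv.ae_eq_zero]

lemma IsTorsionPair.energy_diff_le {Ω : Set (Euc d)} (hΩm : NullMeasurableSet Ω volume)
    (hΩ : volume Ω < ⊤)
    {w wU : Euc d → ℝ} {g gU : Euc d → Euc d} (hw : IsTorsionPair Ω w g) {e : Euc d}
    (he : ‖e‖ ≤ 1) (t : ℝ) {δ : ℝ} (hδ : 0 < δ) (hδ1 : δ ≤ 1)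
    (hPU : perimeter (Ω \ halfSpace e (t + δ)) < ⊤)
    (hwU : IsTorsionPair (Ω \ halfSpace e (t + δ)) wU gU) :
    energy (Ω \ halfSpace e (t + δ)) - energy Ω ≤
      (1 / 2) * (cacc / δ ^ 2 * tailMass Ω w e t) := by
  obtain ⟨v, h, hv, hle⟩ := hw.torsionFunctional_cut_sub_le hΩ he t hδ hδ1
  have h1 := hwU.energy_le hv
  have hUm : NullMeasurableSet (Ω \ halfSpace e (t + δ)) volume :=
    hΩm.diff (measurableSet_halfSpace e _).nullMeasurableSet
  rw [hv.torsionFunctional_eq_of_subset Set.sdiff_subset hUm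
    ((measure_mono Set.sdiff_subset).trans_lt hΩ) hPU, ← hw.energy_eq] at hle
  linarith

/-- The energy gap is half the squared gradient distance of the torsion functions, and Poincaré on Ω
converts this to L². It verifies the closeness condition in the definition of a subsolution. -/
lemma IsTorsionPair.integral_sub_sq_le {Ω U : Set (Euc d)} (hΩm : NullMeasurableSet Ω volume)
    (hΩ : volume Ω < ⊤) (hP : perimeter Ω < ⊤) (hUΩ : U ⊆ Ω) (hU : NullMeasurableSet U volume)
    (hPU : perimeter U < ⊤) {w wU : Euc d → ℝ} {g gU : Euc d → Euc d} (hw : IsTorsionPair Ω w g)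
    (hwU : IsTorsionPair U wU gU) {r : ℝ} (hr : 0 < r)
    (hball : 2 * volume.real Ω ≤ volume.real (ball (0 : Euc d) r)) :
    ∫ x, (w x - wU x) ^ 2 ≤ 2 * r ^ 2 * (energy U - energy Ω) := by
  have hwU' := hwU.isSobolevLike.mono hUΩ
  have hpoin := (hw.isSobolevLike.sub hwU').integral_sq_le hΩ hr hball
  have hz := (hw.isSobolevLike.sub hwU').grad_ae_eq_zero hΩm hΩ hP
  rw [← setIntegral_norm_sq_eq_integral hz] at hpoin
  have h1 := hw.torsionFunctional_eq hwU'
  rw [hwU.isSobolevLike.torsionFunctional_eq_of_subset hUΩ hU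
    ((measure_mono hUΩ).trans_lt hΩ) hPU, ← hw.energy_eq, ← hwU.energy_eq] at h1
  have h2 : ∫ x in Ω, ‖gU x - g x‖ ^ 2 = ∫ x in Ω, ‖(g - gU) x‖ ^ 2 := by
    simp only [Pi.sub_apply, norm_sub_rev]
  have h3 : ∫ x, (w x - wU x) ^ 2 = ∫ x, (w - wU) x ^ 2 := rfl
  rw [h3]
  refine hpoin.trans (le_of_eq ?_)
  rw [← h2]
  linear_combination (-2 * r ^ 2) * h1

lemma eLpNorm_two_le_of_integral_sq_le {f : Euc d → ℝ} (hf : MemLp f 2 volume) {ε : ℝ}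
    (hε : 0 ≤ ε) (h : ∫ x, f x ^ 2 ≤ ε ^ 2) : eLpNorm f 2 volume ≤ ENNReal.ofReal ε := by
  rw [← ENNReal.ofReal_toReal hf.2.ne, ← Lp.norm_toLp f hf]
  refine ENNReal.ofReal_le_ofReal (abs_le_of_sq_le_sq' ?_ hε).2
  rw [norm_toLp_sq hf]
  simpa using h

end Decay

/-! ### Perimeter of the two pieces cut by a hyperplane. -/

section PerimeterSplit

variable {d : ℕ}

lemma perimeter_le_ofReal {A : Set (Euc d)} {B : ℝ}
    (h : ∀ X : Euc d → Euc d, ContDiff ℝ 1 X → HasCompactSupport X → (∀ x, ‖X x‖ ≤ 1) →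
      ∫ x in A, divergence X x ≤ B) : perimeter A ≤ ENNReal.ofReal B :=
  iSup_le fun X => iSup_le fun h1 => iSup_le fun h2 => iSup_le fun h3 =>
    ENNReal.ofReal_le_ofReal (h X h1 h2 h3)

lemma divergence_zero : divergence (0 : Euc d → Euc d) = 0 := by
  ext x
  have : fderiv ℝ (0 : Euc d → Euc d) x = 0 := by simp [Pi.zero_def]
  simp [divergence, this]

lemma continuous_divergence {X : Euc d → Euc d} (hX : ContDiff ℝ 1 X) :
    Continuous (divergence X) := by
  unfold divergence
  refine continuous_finsetSum _ fun i _ => ?_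
  have : Continuous fun x => fderiv ℝ X x (EuclideanSpace.single i 1) :=
    (hX.continuous_fderiv (by norm_num)).clm_apply continuous_const
  fun_prop

lemma hasCompactSupport_divergence {X : Euc d → Euc d} (hX : HasCompactSupport X) :
    HasCompactSupport (divergence X) := by
  refine HasCompactSupport.mono (hX.fderiv ℝ) fun x hx => ?_
  contrapose! hx
  simp only [Function.mem_support, not_not] at hx
  simp [divergence, hx]

lemma integrable_divergence {X : Euc d → Euc d} (hX : ContDiff ℝ 1 X)
    (hc : HasCompactSupport X) : Integrable (divergence X) :=
  (continuous_divergence hX).integrable_of_hasCompactSupport (hasCompactSupport_divergence hc)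

lemma sum_inner_single_mul (a b : Euc d) :
    ∑ i : Fin d, inner ℝ a (EuclideanSpace.single i (1 : ℝ)) * b i = inner ℝ a b := by
  simp [PiLp.inner_apply, mul_comm]

/-- The divergence of a convex combination of two fields. -/
lemma divergence_interpolate {X Y : Euc d → Euc d} (hX : ContDiff ℝ 1 X) (hY : ContDiff ℝ 1 Y)
    {η : Euc d → ℝ} {γ : Euc d → Euc d} (hη : ContDiff ℝ 1 η)
    (hηγ : ∀ x v, fderiv ℝ η x v = inner ℝ (γ x) v) (x : Euc d) :
    divergence (fun x => (1 - η x) • X x + η x • Y x) x =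
      ((1 - η x) * divergence X x + η x * divergence Y x) + inner ℝ (γ x) (Y x - X x) := by
  have h1 := (hX.differentiable (by norm_num) x).hasFDerivAt
  have h2 := (hY.differentiable (by norm_num) x).hasFDerivAt
  have h3 := (hη.differentiable (by norm_num) x).hasFDerivAt
  have h4 := ((h3.const_sub 1).smul h1).add (h3.smul h2)
  have h5 : fderiv ℝ (fun x => (1 - η x) • X x + η x • Y x) x = _ := h4.fderiv
  rw [← sum_inner_single_mul]
  simp only [divergence, h5, Finset.mul_sum, ← Finset.sum_add_distrib]
  refine Finset.sum_congr rfl fun i _ => ?_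
  simp [hηγ]
  ring

lemma norm_interpolate_le {a b : Euc d} (ha : ‖a‖ ≤ 1) (hb : ‖b‖ ≤ 1) {s : ℝ} (h0 : 0 ≤ s)
    (h1 : s ≤ 1) : ‖(1 - s) • a + s • b‖ ≤ 1 := by
  calc _ ≤ ‖(1 - s) • a‖ + ‖s • b‖ := norm_add_le _ _
    _ = (1 - s) * ‖a‖ + s * ‖b‖ := by
      rw [norm_smul, norm_smul, Real.norm_of_nonneg h0, Real.norm_of_nonneg (by linarith)]
    _ ≤ (1 - s) * 1 + s * 1 := by gcongr
    _ = 1 := by ring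

lemma measureReal_inter_slab {Ω : Set (Euc d)}
    (hΩ : volume Ω < ⊤) (e : Euc d) {s t : ℝ} (hst : s ≤ t) :
    volume.real (Ω ∩ (halfSpace e s \ halfSpace e t)) =
      volume.real (Ω ∩ halfSpace e s) - volume.real (Ω ∩ halfSpace e t) := by
  have h := measureReal_sdiff_add_inter (μ := volume) (s := Ω ∩ halfSpace e s)
    (measurableSet_halfSpace e t) ((measure_mono Set.inter_subset_left).trans_lt hΩ).ne
  have h1 : Ω ∩ (halfSpace e s \ halfSpace e t) = (Ω ∩ halfSpace e s) \ halfSpace e t := by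
    ext x
    simp only [Set.mem_inter_iff, Set.mem_sdiff]
    tauto
  have h2 : Ω ∩ halfSpace e s ∩ halfSpace e t = Ω ∩ halfSpace e t := by
    rw [Set.inter_assoc, Set.inter_eq_right.2 (halfSpace_anti e hst)]
  rw [h1]
  rw [h2] at h
  linarith

lemma neg_inner_cutoffGrad_le {e : Euc d} (he : ‖e‖ ≤ 1) (s : ℝ) {δ : ℝ} (hδ : 0 < δ)
    {W : Euc d → Euc d} (hW : ∀ x, ‖W x‖ ≤ 2) (x : Euc d) :
    -inner ℝ (cutoffGrad e s δ x) (W x) ≤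
      (halfSpace e s \ halfSpace e (s + δ)).indicator (fun _ => 2 * transitionBound / δ) x := by
  have hLnn := transitionBound_nonneg
  by_cases hx : x ∈ halfSpace e s \ halfSpace e (s + δ)
  · rw [Set.indicator_of_mem hx]
    calc -inner ℝ (cutoffGrad e s δ x) (W x) ≤ ‖cutoffGrad e s δ x‖ * ‖W x‖ :=
          (neg_le_abs _).trans (abs_real_inner_le_norm _ _)
      _ ≤ transitionBound / δ * 2 := by
          gcongr
          · exact norm_cutoffGrad_le he s hδ x
          · exact hW x
      _ = _ := by ring
  · rw [Set.indicator_of_notMem hx]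
    have : cutoffGrad e s δ x = 0 := by
      by_cases hxs : x ∈ halfSpace e s
      · refine cutoffGrad_eq_zero_of_mem hδ ?_
        by_contra hc
        exact hx ⟨hxs, hc⟩
      · exact cutoffGrad_eq_zero hδ hxs
    simp [this]

/-- The gradient is at most `transitionBound` / δ and lives on a slab meeting Ω in volume at most
cδ, so δ cancels. -/
lemma neg_setIntegral_inner_cutoffGrad_le {Ω : Set (Euc d)}
    (hΩ : volume Ω < ⊤) {e : Euc d} (he : ‖e‖ ≤ 1) {s c δ : ℝ} (hδ : 0 < δ)
    (hc : volume.real (Ω ∩ halfSpace e s) - volume.real (Ω ∩ halfSpace e (s + δ)) ≤ c * δ)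
    {W : Euc d → Euc d} (hWi : Integrable fun x => inner ℝ (cutoffGrad e s δ x) (W x))
    (hW : ∀ x, ‖W x‖ ≤ 2) :
    -(∫ x in Ω, inner ℝ (cutoffGrad e s δ x) (W x)) ≤ 2 * transitionBound * c := by
  have : IsFiniteMeasure (volume.restrict Ω) := ⟨by simpa using hΩ⟩
  have hSm : MeasurableSet (halfSpace e s \ halfSpace e (s + δ)) :=
    (measurableSet_halfSpace e _).diff (measurableSet_halfSpace e _)
  have hLnn := transitionBound_nonneg
  rw [← integral_neg]
  calc ∫ x in Ω, -inner ℝ (cutoffGrad e s δ x) (W x)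
      ≤ ∫ x in Ω, (halfSpace e s \ halfSpace e (s + δ)).indicator
          (fun _ => 2 * transitionBound / δ) x :=
        integral_mono hWi.integrableOn.neg ((integrable_const _).indicator hSm)
          (neg_inner_cutoffGrad_le he s hδ hW)
    _ = volume.real (Ω ∩ (halfSpace e s \ halfSpace e (s + δ))) * (2 * transitionBound / δ) := by
        rw [setIntegral_indicator hSm]
        simp
    _ ≤ c * δ * (2 * transitionBound / δ) := by
        rw [measureReal_inter_slab hΩ e (by linarith)]
        gcongr
    _ = 2 * transitionBound * c := by field_simp

/-- The interpolated field (1 - η)X + ηY is admissible for P(Ω). Its divergence exceeds the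
interpolated divergences by ⟨∇η, Y - X⟩ with |Y - X| ≤ 2, which is the error term. -/
lemma setIntegral_interpolate_le {Ω : Set (Euc d)}
    (hΩ : volume Ω < ⊤) (hP : perimeter Ω < ⊤) {e : Euc d} (he : ‖e‖ ≤ 1) {s c δ : ℝ}
    (hδ : 0 < δ)
    (hc : volume.real (Ω ∩ halfSpace e s) - volume.real (Ω ∩ halfSpace e (s + δ)) ≤ c * δ)
    {X Y : Euc d → Euc d} (hX : ContDiff ℝ 1 X) (hXc : HasCompactSupport X)
    (hX1 : ∀ x, ‖X x‖ ≤ 1) (hY : ContDiff ℝ 1 Y) (hYc : HasCompactSupport Y)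
    (hY1 : ∀ x, ‖Y x‖ ≤ 1) :
    ∫ x in Ω, ((1 - cutoff e s δ x) * divergence X x + cutoff e s δ x * divergence Y x) ≤
      (perimeter Ω).toReal + 2 * transitionBound * c := by
  have hη : ContDiff ℝ 1 (cutoff e s δ) := (contDiff_cutoff e s δ).of_le (by exact_mod_cast le_top)
  have hZ1 : ContDiff ℝ 1 (fun x => (1 - cutoff e s δ x) • X x + cutoff e s δ x • Y x) :=
    ((contDiff_const.sub hη).smul hX).add (hη.smul hY)
  have hZc : HasCompactSupport (fun x => (1 - cutoff e s δ x) • X x + cutoff e s δ x • Y x) :=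
    HasCompactSupport.add (hXc.smul_left (f := fun x => 1 - cutoff e s δ x))
      (hYc.smul_left (f := cutoff e s δ))
  have hZP := setIntegral_divergence_le_perimeter hP hZ1 hZc fun x =>
    norm_interpolate_le (hX1 x) (hY1 x) (cutoff_nonneg e s δ x) (cutoff_le_one e s δ x)
  simp only [divergence_interpolate hX hY hη (fderiv_cutoff e s δ)] at hZP
  have hDi : Integrable (fun x =>
      (1 - cutoff e s δ x) * divergence X x + cutoff e s δ x * divergence Y x) := by
    refine Continuous.integrable_of_hasCompactSupport ?_ ?_
    · have h1 := hη.continuous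
      have h2 := continuous_divergence hX
      have h3 := continuous_divergence hY
      fun_prop
    · exact HasCompactSupport.add (hasCompactSupport_divergence hXc).mul_left
        (hasCompactSupport_divergence hYc).mul_left
  have hIi : Integrable (fun x => inner ℝ (cutoffGrad e s δ x) (Y x - X x)) := by
    refine Continuous.integrable_of_hasCompactSupport
      ((continuous_cutoffGrad e s δ).inner (hY.continuous.sub hX.continuous)) ?_
    refine HasCompactSupport.mono (hYc.sub hXc) fun x hx => ?_
    contrapose! hx
    have hx' : Y x - X x = 0 := by simpa using hx
    simp [hx']
  have hI := neg_setIntegral_inner_cutoffGrad_le hΩ he hδ hc hIi fun x =>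
    ((norm_sub_le _ _).trans (add_le_add (hY1 x) (hX1 x))).trans (by norm_num)
  rw [integral_add hDi.integrableOn hIi.integrableOn] at hZP
  linarith

lemma tendsto_cutoff (e : Euc d) (s : ℝ) (x : Euc d) :
    Filter.Tendsto (fun δ => cutoff e s δ x) (nhdsWithin 0 (Set.Ioi 0))
      (nhds ((halfSpace e s).indicator 1 x)) := by
  refine tendsto_const_nhds.congr' ?_
  by_cases hx : x ∈ halfSpace e s
  · have hpos : 0 < inner ℝ e x - s := sub_pos.2 hx
    filter_upwards [Ioo_mem_nhdsGT hpos] with δ hδ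
    rw [Set.indicator_of_mem hx, cutoff_eq_one hδ.1 (by linarith [hδ.2])]
    rfl
  · filter_upwards [self_mem_nhdsWithin] with δ hδ
    rw [Set.indicator_of_notMem hx, cutoff_eq_zero hδ hx]

/-- The interpolation bound does not depend on δ. As δ → 0 the cut-offs tend to the indicator of the
half space, which decouples X and Y. -/
lemma setIntegral_divergence_add_le {Ω : Set (Euc d)}
    (hΩ : volume Ω < ⊤) (hP : perimeter Ω < ⊤) {e : Euc d} (he : ‖e‖ ≤ 1) {s c a : ℝ}
    (ha : 0 < a)
    (hc : ∀ δ, 0 < δ → δ < a →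
      volume.real (Ω ∩ halfSpace e s) - volume.real (Ω ∩ halfSpace e (s + δ)) ≤ c * δ)
    {X Y : Euc d → Euc d} (hX : ContDiff ℝ 1 X) (hXc : HasCompactSupport X)
    (hX1 : ∀ x, ‖X x‖ ≤ 1) (hY : ContDiff ℝ 1 Y) (hYc : HasCompactSupport Y)
    (hY1 : ∀ x, ‖Y x‖ ≤ 1) :
    (∫ x in Ω \ halfSpace e s, divergence X x) + ∫ x in Ω ∩ halfSpace e s, divergence Y x ≤
      (perimeter Ω).toReal + 2 * transitionBound * c := by
  have hiX := integrable_divergence hX hXc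
  have hiY := integrable_divergence hY hYc
  have hm := measurableSet_halfSpace e s
  have hlim : Filter.Tendsto (fun δ => ∫ x in Ω,
      ((1 - cutoff e s δ x) * divergence X x + cutoff e s δ x * divergence Y x))
      (nhdsWithin 0 (Set.Ioi 0)) (nhds (∫ x in Ω, ((1 - (halfSpace e s).indicator 1 x) *
        divergence X x + (halfSpace e s).indicator 1 x * divergence Y x))) := by
    refine tendsto_integral_filter_of_dominated_convergence
      (fun x => |divergence X x| + |divergence Y x|) ?_ ?_
      (hiX.abs.add hiY.abs).integrableOn ?_
    · refine Filter.Eventually.of_forall fun δ => Continuous.aestronglyMeasurable ?_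
      have h1 := (contDiff_cutoff e s δ).continuous
      have h2 := continuous_divergence hX
      have h3 := continuous_divergence hY
      fun_prop
    · refine Filter.Eventually.of_forall fun δ => Filter.Eventually.of_forall fun x => ?_
      have h0 := cutoff_nonneg e s δ x
      have h1 := cutoff_le_one e s δ x
      refine (norm_add_le _ _).trans (add_le_add ?_ ?_)
      · rw [norm_mul, Real.norm_of_nonneg (by linarith)]
        exact mul_le_of_le_one_left (norm_nonneg _) (by linarith)
      · rw [norm_mul, Real.norm_of_nonneg h0]
        exact mul_le_of_le_one_left (norm_nonneg _) h1
    · refine Filter.Eventually.of_forall fun x => ?_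
      exact (((tendsto_cutoff e s x).const_sub 1).mul_const _).add
        ((tendsto_cutoff e s x).mul_const _)
  have hval : ∫ x in Ω, ((1 - (halfSpace e s).indicator 1 x) *
        divergence X x + (halfSpace e s).indicator 1 x * divergence Y x) =
      (∫ x in Ω \ halfSpace e s, divergence X x) + ∫ x in Ω ∩ halfSpace e s, divergence Y x := by
    rw [Set.sdiff_eq, ← setIntegral_indicator hm.compl, ← setIntegral_indicator hm,
      ← integral_add (hiX.integrableOn.indicator hm.compl) (hiY.integrableOn.indicator hm)]
    congr 1
    ext x
    by_cases hx : x ∈ halfSpace e s <;> simp [hx]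
  rw [← hval]
  refine le_of_tendsto hlim ?_
  filter_upwards [Ioo_mem_nhdsGT ha] with δ hδ
  exact setIntegral_interpolate_le hΩ hP he hδ.1 (hc δ hδ.1 hδ.2) hX hXc hX1 hY hYc hY1

/-- Cutting along a hyperplane across which `Ω` has small volume growth adds little perimeter. -/
lemma perimeter_split {Ω : Set (Euc d)}
    (hΩ : volume Ω < ⊤) (hP : perimeter Ω < ⊤) {e : Euc d} (he : ‖e‖ ≤ 1) {s c a : ℝ}
    (ha : 0 < a)
    (hc : ∀ δ, 0 < δ → δ < a →
      volume.real (Ω ∩ halfSpace e s) - volume.real (Ω ∩ halfSpace e (s + δ)) ≤ c * δ) :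
    perimeter (Ω \ halfSpace e s) < ⊤ ∧ perimeter (Ω ∩ halfSpace e s) < ⊤ ∧
      (perimeter (Ω \ halfSpace e s)).toReal + (perimeter (Ω ∩ halfSpace e s)).toReal ≤
        (perimeter Ω).toReal + 2 * transitionBound * c := by
  set B := (perimeter Ω).toReal + 2 * transitionBound * c
  have key := fun X hX hXc hX1 Y hY hYc hY1 => setIntegral_divergence_add_le hΩ hP he ha hc
    (X := X) (Y := Y) hX hXc hX1 hY hYc hY1
  have z1 : ContDiff ℝ 1 (0 : Euc d → Euc d) := contDiff_const
  have z2 : HasCompactSupport (0 : Euc d → Euc d) := HasCompactSupport.zero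
  have z3 : ∀ x, ‖(0 : Euc d → Euc d) x‖ ≤ 1 := by simp
  have f1 : perimeter (Ω \ halfSpace e s) < ⊤ := by
    refine (perimeter_le_ofReal (B := B) fun X hX hXc hX1 => ?_).trans_lt ENNReal.ofReal_lt_top
    simpa [divergence_zero] using key X hX hXc hX1 0 z1 z2 z3
  have f2 : perimeter (Ω ∩ halfSpace e s) < ⊤ := by
    refine (perimeter_le_ofReal (B := B) fun Y hY hYc hY1 => ?_).trans_lt ENNReal.ofReal_lt_top
    simpa [divergence_zero] using key 0 z1 z2 z3 Y hY hYc hY1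
  refine ⟨f1, f2, ?_⟩
  have h1 : ∀ X : Euc d → Euc d, ContDiff ℝ 1 X → HasCompactSupport X → (∀ x, ‖X x‖ ≤ 1) →
      ∫ x in Ω \ halfSpace e s, divergence X x ≤ B - (perimeter (Ω ∩ halfSpace e s)).toReal := by
    intro X hX hXc hX1
    -- With X fixed, the supremum over Y is taken first, then the one over X. Nonnegativity is
    -- needed because `ENNReal.ofReal` truncates at zero.
    have hnn : 0 ≤ B - ∫ x in Ω \ halfSpace e s, divergence X x := by
      have := key X hX hXc hX1 0 z1 z2 z3
      simp only [divergence_zero, Pi.zero_apply, integral_zero, add_zero] at this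
      linarith
    have := ENNReal.toReal_le_of_le_ofReal hnn (perimeter_le_ofReal fun Y hY hYc hY1 => by
      have := key X hX hXc hX1 Y hY hYc hY1
      linarith)
    linarith
  have hnn : 0 ≤ B - (perimeter (Ω ∩ halfSpace e s)).toReal := by
    have := h1 0 z1 z2 z3
    simpa [divergence_zero] using this
  have := ENNReal.toReal_le_of_le_ofReal hnn (perimeter_le_ofReal h1)
  linarith

end PerimeterSplit

/-! ### Choice of the cutting height and the De Giorgi iteration. -/

section Iteration

variable {d : ℕ}

lemma measureReal_inter_halfSpace_anti {Ω : Set (Euc d)} (hΩ : volume Ω < ⊤) (e : Euc d) :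
    Antitone fun t => volume.real (Ω ∩ halfSpace e t) := fun _ _ hst =>
  measureReal_mono (Set.inter_subset_inter_right _ (halfSpace_anti e hst))
    ((measure_mono Set.inter_subset_left).trans_lt hΩ).ne

/-- The tail volume is right-continuous because the half spaces are open, and a nonincreasing
right-continuous function is lower semicontinuous. -/
lemma lowerSemicontinuous_measureReal_inter_halfSpace {Ω : Set (Euc d)} (hΩ : volume Ω < ⊤)
    (e : Euc d) : LowerSemicontinuous fun t => volume.real (Ω ∩ halfSpace e t) := by
  intro s y hy
  have : IsFiniteMeasure (volume.restrict Ω) := ⟨by simpa using hΩ⟩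
  have hi : Integrable (fun _ : Euc d => (1 : ℝ)) (volume.restrict Ω) := integrable_const _
  have hV : ∀ t, ∫ x in Ω, (halfSpace e t).indicator (fun _ => (1 : ℝ)) x =
      volume.real (Ω ∩ halfSpace e t) := fun t => by
    rw [setIntegral_indicator (measurableSet_halfSpace e t)]
    simp
  have h := tendsto_integral_filter_of_dominated_convergence (μ := volume.restrict Ω)
    (l := nhdsWithin s (Set.Ioi s)) (f := (halfSpace e s).indicator fun _ => (1 : ℝ))
    (F := fun t : ℝ => (halfSpace e t).indicator fun _ => (1 : ℝ)) (fun _ => 1)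
    (Filter.Eventually.of_forall fun t => hi.1.indicator (measurableSet_halfSpace e t))
    (Filter.Eventually.of_forall fun t => Filter.Eventually.of_forall fun x =>
      (norm_indicator_le_norm_self _ _).trans (by simp)) hi
    (Filter.Eventually.of_forall fun x => by
      refine tendsto_const_nhds.congr' ?_
      by_cases hx : x ∈ halfSpace e s
      · filter_upwards [Ioo_mem_nhdsGT (mem_halfSpace.1 hx)] with t ht
        rw [Set.indicator_of_mem hx, Set.indicator_of_mem (mem_halfSpace.2 ht.2)]
      · filter_upwards [self_mem_nhdsWithin] with t ht
        rw [Set.indicator_of_notMem hx,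
          Set.indicator_of_notMem fun hxt => hx (halfSpace_anti e (le_of_lt ht) hxt)])
  simp only [hV] at h
  obtain ⟨t, hyt, hst⟩ := ((h.eventually (lt_mem_nhds hy)).and self_mem_nhdsWithin).exists
  filter_upwards [Iio_mem_nhds (show s < t from hst)] with s' hs'
  exact hyt.trans_le (measureReal_inter_halfSpace_anti hΩ e (le_of_lt hs'))

/-- A nonincreasing function has a point of small slope in every interval. -/
lemma exists_slope_le {V : ℝ → ℝ} (hlsc : LowerSemicontinuous V) (hnn : ∀ t, 0 ≤ V t) (t : ℝ)
    {δ : ℝ} (hδ : 0 < δ) :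
    ∃ s ∈ Set.Ico t (t + δ), ∀ h, 0 < h → h < t + δ - s → V s - V (s + h) ≤ V t / δ * h := by
  -- The slope V(t)/δ is chosen so that F(t) ≤ F(t + δ). A minimum can then be taken at some s < t +
  -- δ, and F(s) ≤ F(s + h) is the claim.
  set F : ℝ → ℝ := fun s => V s + V t / δ * s with hF
  have hFl : LowerSemicontinuousOn F (Set.Icc t (t + δ)) :=
    (hlsc.add (continuous_const.mul continuous_id).lowerSemicontinuous).lowerSemicontinuousOn _
  obtain ⟨m, hm, hmin⟩ := hFl.exists_isMinOn (Set.nonempty_Icc.2 (by linarith)) isCompact_Icc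
  have hend : F t ≤ F (t + δ) := by
    have : V t / δ * (t + δ) = V t / δ * t + V t := by field_simp
    simp only [hF, this]
    linarith [hnn (t + δ)]
  obtain ⟨s, hs, hsmin⟩ : ∃ s ∈ Set.Ico t (t + δ), ∀ z ∈ Set.Icc t (t + δ), F s ≤ F z := by
    rcases hm.2.lt_or_eq with h | h
    · exact ⟨m, ⟨hm.1, h⟩, fun z hz => hmin hz⟩
    · refine ⟨t, ⟨le_rfl, by linarith⟩, fun z hz => hend.trans ?_⟩
      rw [← h]
      exact hmin hz
  refine ⟨s, hs, fun h h0 h1 => ?_⟩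
  have := hsmin (s + h) ⟨by linarith [hs.1], by linarith⟩
  simp only [hF] at this
  linarith

lemma exists_eq_zero_of_decay {Y : ℝ → ℝ} (hd : 0 < d) (hanti : Antitone Y)
    (hnn : ∀ t, 0 ≤ Y t) (hlim : Filter.Tendsto Y Filter.atTop (nhds 0)) {c K T₀ : ℝ}
    (hc : 0 < c) (hK : 0 < K)
    (hstep : ∀ t, T₀ ≤ t → ∀ δ, 0 < δ → δ ≤ 1 → ∀ r, 0 < r → r ≤ 1 → 2 * Y t ≤ r ^ d * c →
      Y (t + 2 * δ) ≤ K * r / δ ^ 2 * Y t) : ∃ T, Y T = 0 := by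
  -- At step n the scales are δ = 2⁻ⁿ and r = r₀ 4⁻ⁿ, so K r/δ² = K r₀ for every n; r₀ makes this at
  -- most 4⁻ᵈ, the factor by which rᵈ shrinks.
  set r₀ : ℝ := min 1 (1 / (K * 4 ^ d)) with hr₀
  have hr₀pos : 0 < r₀ := by positivity
  have hr₀1 : r₀ ≤ 1 := min_le_left _ _
  have hKr : K * r₀ ≤ (1 / 4) ^ d := by
    calc K * r₀ ≤ K * (1 / (K * 4 ^ d)) := by gcongr; exact min_le_right _ _
      _ = (1 / 4) ^ d := by rw [one_div_pow]; field_simp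
  obtain ⟨T, hT0, hT⟩ : ∃ T, T₀ ≤ T ∧ 2 * Y T ≤ r₀ ^ d * c := by
    have h1 : ∀ᶠ t in Filter.atTop, Y t < r₀ ^ d * c / 2 :=
      hlim.eventually (gt_mem_nhds (by positivity))
    obtain ⟨T, h2, h3⟩ := (h1.and (Filter.eventually_ge_atTop T₀)).exists
    exact ⟨T, h3, by linarith⟩
  -- The increments are exactly 2 · 2⁻ⁿ = 2δ, and all heights stay below T + 4.
  set t : ℕ → ℝ := fun n => T + 4 * (1 - (1 / 2) ^ n) with ht
  have htT : ∀ n, T ≤ t n := fun n => by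
    have : ((1 : ℝ) / 2) ^ n ≤ 1 := pow_le_one₀ (by norm_num) (by norm_num)
    simp only [ht]
    linarith
  have htT' : ∀ n, t n ≤ T + 4 := fun n => by
    have : (0 : ℝ) ≤ (1 / 2) ^ n := by positivity
    simp only [ht]
    linarith
  have key : ∀ n, 2 * Y (t n) ≤ (r₀ * (1 / 4) ^ n) ^ d * c := by
    intro n
    induction n with
    | zero => simpa [ht] using hT
    | succ n ih =>
      have h1 := hstep (t n) (hT0.trans (htT n)) ((1 / 2) ^ n) (by positivity)
        (pow_le_one₀ (by norm_num) (by norm_num)) (r₀ * (1 / 4) ^ n) (by positivity)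
        (mul_le_one₀ hr₀1 (by positivity) (pow_le_one₀ (by norm_num) (by norm_num))) ih
      have e1 : t n + 2 * (1 / 2) ^ n = t (n + 1) := by simp only [ht, pow_succ]; ring
      have e2 : K * (r₀ * (1 / 4) ^ n) / ((1 / 2) ^ n) ^ 2 = K * r₀ := by
        have : ((1 / 2 : ℝ) ^ n) ^ 2 = (1 / 4) ^ n := by rw [← pow_mul, mul_comm, pow_mul]; norm_num
        rw [this]
        field_simp
      rw [e1, e2] at h1
      calc 2 * Y (t (n + 1)) ≤ K * r₀ * (2 * Y (t n)) := by linarith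
        _ ≤ (1 / 4) ^ d * ((r₀ * (1 / 4) ^ n) ^ d * c) := by
            gcongr
            linarith [hnn (t n)]
        _ = (r₀ * (1 / 4) ^ (n + 1)) ^ d * c := by
            rw [← mul_assoc, ← mul_pow, pow_succ]
            ring
  refine ⟨T + 4, le_antisymm ?_ (hnn _)⟩
  have hlim0 : Filter.Tendsto (fun n : ℕ => (r₀ * (1 / 4 : ℝ) ^ n) ^ d * c / 2) Filter.atTop
      (nhds ((r₀ * 0) ^ d * c / 2)) :=
    ((((tendsto_pow_atTop_nhds_zero_of_lt_one (by norm_num) (by norm_num)).const_mul r₀).pow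
      d).mul_const c).div_const 2
  rw [mul_zero, zero_pow hd.ne', zero_mul, zero_div] at hlim0
  exact ge_of_tendsto' hlim0 fun n => (hanti (htT' n)).trans (by linarith [key n])

/-- The inequality that drives the iteration: comparison of a subsolution with its part on one
side of a well chosen hyperplane. -/
lemma tailMass_decay (hd : 0 < d) {Ω : Set (Euc d)} (hΩm : NullMeasurableSet Ω volume)
    (hΩ : volume Ω < ⊤) (hP : perimeter Ω < ⊤) {ε k : ℝ} (hε : 0 < ε) (hk : 0 < k)
    (hsub : ∀ U : Set (Euc d), U ⊆ Ω → NullMeasurableSet U volume →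
      ∀ wΩ wU : Euc d → ℝ, IsTorsionFunction Ω wΩ → IsTorsionFunction U wU →
        eLpNorm (fun x => wΩ x - wU x) 2 volume ≤ ENNReal.ofReal ε →
        perimeter U < ⊤ →
        energy Ω + k * (perimeter Ω).toReal ≤ energy U + k * (perimeter U).toReal)
    {w : Euc d → ℝ} {g : Euc d → Euc d} (hw : IsTorsionPair Ω w g) {e : Euc d} (he : ‖e‖ ≤ 1)
    {R : ℝ} (hR : 0 < R) (hRball : 2 * volume.real Ω ≤ volume.real (ball (0 : Euc d) R))
    {t : ℝ} (hclose : R ^ 2 * (cacc * tailMass Ω w e (t - 1)) ≤ ε ^ 2)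
    {δ : ℝ} (hδ : 0 < δ) (hδ1 : δ ≤ 1) {r : ℝ} (hr : 0 < r) (hr1 : r ≤ 1)
    (hball : 2 * tailMass Ω w e t ≤ volume.real (ball (0 : Euc d) r)) :
    tailMass Ω w e (t + 2 * δ) ≤
      (cacc / k + 4 * transitionBound + cacc) * r / δ ^ 2 * tailMass Ω w e t := by
  have hw2 := hw.isSobolevLike.isH1.memLp
  have hYanti := tailMass_anti hΩ hw2 e
  have hVanti := measureReal_inter_halfSpace_anti hΩ e
  have hVY := measureReal_le_tailMass hΩ hw2 e
  -- Starting at t + δ leaves room of width δ for the cut-off between t and s.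
  obtain ⟨s, hs, hslope⟩ := exists_slope_le (lowerSemicontinuous_measureReal_inter_halfSpace hΩ e)
    (fun _ => measureReal_nonneg) (t + δ) hδ
  obtain ⟨hPU, hPA, hsplit⟩ := perimeter_split hΩ hP he (by linarith [hs.2]) hslope
  set Y := tailMass Ω w e t with hY
  have hY0 : 0 ≤ Y := tailMass_nonneg _ _ _ _
  have hUm : NullMeasurableSet (Ω \ halfSpace e s) volume :=
    hΩm.diff (measurableSet_halfSpace e _).nullMeasurableSet
  have hAm : NullMeasurableSet (Ω ∩ halfSpace e s) volume :=
    hΩm.inter (measurableSet_halfSpace e _).nullMeasurableSet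
  have hUf : volume (Ω \ halfSpace e s) < ⊤ := (measure_mono Set.sdiff_subset).trans_lt hΩ
  have hAf : volume (Ω ∩ halfSpace e s) < ⊤ := (measure_mono Set.inter_subset_left).trans_lt hΩ
  obtain ⟨wU, gU, hwU⟩ := exists_isTorsionPair hd hUm hUf hPU
  have hen : ∀ h, 0 < h → h ≤ 1 → energy (Ω \ halfSpace e s) - energy Ω ≤
      (1 / 2) * (cacc / h ^ 2 * tailMass Ω w e (s - h)) := by
    intro h h0 h1
    have := hw.energy_diff_le (wU := wU) (gU := gU) hΩm hΩ he (s - h) h0 h1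
    rw [sub_add_cancel] at this
    exact this hPU hwU
  have hcacc := cacc_pos
  have hsq : ∫ x, (w x - wU x) ^ 2 ≤ ε ^ 2 := by
    refine (hw.integral_sub_sq_le hΩm hΩ hP Set.sdiff_subset hUm hPU hwU hR hRball).trans
      (le_trans ?_ hclose)
    -- Closeness uses a cut-off of width 1, so its bound does not degenerate as δ → 0; this is why
    -- the hypothesis involves height t - 1.
    have h1 := hen 1 one_pos le_rfl
    have h2 : tailMass Ω w e (s - 1) ≤ tailMass Ω w e (t - 1) := hYanti (by linarith [hs.1])
    have h3 : energy (Ω \ halfSpace e s) - energy Ω ≤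
        (1 / 2) * (cacc * tailMass Ω w e (t - 1)) := by
      refine h1.trans ?_
      rw [one_pow, div_one]
      gcongr
    calc 2 * R ^ 2 * (energy (Ω \ halfSpace e s) - energy Ω)
        ≤ 2 * R ^ 2 * ((1 / 2) * (cacc * tailMass Ω w e (t - 1))) := by gcongr
      _ = _ := by ring
  have hcomp := hsub _ Set.sdiff_subset hUm w wU hw.isTorsionFunction hwU.isTorsionFunction
    (eLpNorm_two_le_of_integral_sq_le (hw2.sub hwU.isSobolevLike.isH1.memLp) hε.le hsq) hPU
  have hen1 : energy (Ω \ halfSpace e s) - energy Ω ≤ (1 / 2) * (cacc * (Y / δ ^ 2)) := by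
    refine (hen δ hδ hδ1).trans ?_
    have : tailMass Ω w e (s - δ) ≤ Y := hYanti (by linarith [hs.1])
    calc (1 / 2) * (cacc / δ ^ 2 * tailMass Ω w e (s - δ))
        ≤ (1 / 2) * (cacc / δ ^ 2 * Y) := by gcongr
      _ = _ := by ring
  have hVs : volume.real (Ω ∩ halfSpace e (t + δ)) ≤ Y :=
    (hVanti (show t ≤ t + δ by linarith)).trans (hVY t)
  have hL := transitionBound_nonneg
  -- Since δ ≤ 1, the perimeter error of order Y/δ is absorbed into Y/δ², the scale of the energy
  -- error.
  have hc : volume.real (Ω ∩ halfSpace e (t + δ)) / δ ≤ Y / δ ^ 2 := by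
    refine div_le_div₀ hY0 hVs (by positivity) ?_
    nlinarith
  set Q := Y / δ ^ 2 with hQ
  have hQ0 : 0 ≤ Q := by positivity
  have hper : (perimeter (Ω ∩ halfSpace e s)).toReal ≤
      (1 / 2 * (cacc / k) + 2 * transitionBound) * Q := by
    have h1 : k * (perimeter (Ω ∩ halfSpace e s)).toReal ≤
        k * ((1 / 2 * (cacc / k) + 2 * transitionBound) * Q) := by
      have e1 : k * ((1 / 2 * (cacc / k) + 2 * transitionBound) * Q) =
          1 / 2 * (cacc * Q) + k * (2 * transitionBound * Q) := by field_simp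
      have h2 : k * ((perimeter (Ω \ halfSpace e s)).toReal +
          (perimeter (Ω ∩ halfSpace e s)).toReal) ≤
          k * ((perimeter Ω).toReal + 2 * transitionBound * Q) := by
        refine mul_le_mul_of_nonneg_left (hsplit.trans ?_) hk.le
        gcongr
      rw [e1]
      linarith
    exact le_of_mul_le_mul_left h1 hk
  have hVs' : volume.real (Ω ∩ halfSpace e s) ≤ Y :=
    (hVanti (show t ≤ s by linarith [hs.1])).trans (hVY t)
  have hiso := measureReal_le_mul_perimeter hAm hAf hPA hr (by linarith)
  have hV2 : volume.real (Ω ∩ halfSpace e (t + 2 * δ)) ≤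
      (cacc / k + 4 * transitionBound) * r * Q := by
    calc volume.real (Ω ∩ halfSpace e (t + 2 * δ)) ≤ volume.real (Ω ∩ halfSpace e s) :=
          hVanti (by linarith [hs.2])
      _ ≤ 2 * r * ((1 / 2 * (cacc / k) + 2 * transitionBound) * Q) := by
          refine hiso.trans ?_
          gcongr
      _ = _ := by ring
  have hW2 : ∫ x in Ω ∩ halfSpace e (t + 2 * δ), w x ^ 2 ≤ cacc * r * Q := by
    calc ∫ x in Ω ∩ halfSpace e (t + 2 * δ), w x ^ 2
        ≤ ∫ x in Ω ∩ halfSpace e (t + δ), w x ^ 2 :=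
          setIntegral_mono_set hw2.integrable_sq.integrableOn
            (Filter.Eventually.of_forall fun x => sq_nonneg _)
            (Set.inter_subset_inter_right _ (halfSpace_anti e (by linarith))).eventuallyLE
      _ ≤ r ^ 2 * (cacc / δ ^ 2 * Y) :=
          hw.setIntegral_sq_le hΩm hΩ hP he t hδ hδ1 hr (by linarith [hVY t])
      _ = r ^ 2 * (cacc * Q) := by rw [hQ]; ring
      _ ≤ r * (cacc * Q) := by
          gcongr
          nlinarith
      _ = cacc * r * Q := by ring
  rw [tailMass_eq_add hΩ hw2]
  calc _ ≤ (cacc / k + 4 * transitionBound) * r * Q + cacc * r * Q := add_le_add hV2 hW2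
    _ = _ := by rw [hQ]; ring

lemma IsEnergySubsolution.exists_volume_inter_halfSpace_eq_zero (hd : 0 < d) {Ω : Set (Euc d)}
    (h : IsEnergySubsolution Ω) {e : Euc d} (he : ‖e‖ ≤ 1) :
    ∃ T : ℝ, volume (Ω ∩ halfSpace e T) = 0 := by
  obtain ⟨hΩm, hΩ, hP, ε, hε, k, hk, hsub⟩ := h
  obtain ⟨w, g, hw⟩ := exists_isTorsionPair hd hΩm hΩ hP
  obtain ⟨R, hR, hRball⟩ := exists_le_volume_real_ball hd (2 * volume.real Ω)
  have hw2 := hw.isSobolevLike.isH1.memLp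
  have hlim := tendsto_tailMass hΩ hw2 e
  have hanti := tailMass_anti hΩ hw2 e
  have hcacc := cacc_pos
  have hL := transitionBound_nonneg
  obtain ⟨T₀, hT₀⟩ : ∃ T₀, R ^ 2 * (cacc * tailMass Ω w e T₀) ≤ ε ^ 2 := by
    have h1 : Filter.Tendsto (fun t => R ^ 2 * (cacc * tailMass Ω w e t)) Filter.atTop
        (nhds (R ^ 2 * (cacc * 0))) := (hlim.const_mul cacc).const_mul _
    rw [mul_zero, mul_zero] at h1
    obtain ⟨T, hT⟩ := (h1.eventually (gt_mem_nhds (show 0 < ε ^ 2 by positivity))).exists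
    exact ⟨T, hT.le⟩
  obtain ⟨T, hT⟩ := exists_eq_zero_of_decay (T₀ := T₀ + 1)
    (K := cacc / k + 4 * transitionBound + cacc) hd hanti
    (tailMass_nonneg Ω w e) hlim (volume_real_ball_one_pos (d := d)) (by positivity)
    (fun t ht δ hδ hδ1 r hr hr1 hball => by
      refine tailMass_decay hd hΩm hΩ hP hε hk hsub hw he hR hRball ?_ hδ hδ1 hr hr1 ?_
      · refine le_trans ?_ hT₀
        have : tailMass Ω w e (t - 1) ≤ tailMass Ω w e T₀ := hanti (by linarith)
        gcongr
      · rwa [volume_real_ball hd hr.le])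
  refine ⟨T, ?_⟩
  have h0 : volume.real (Ω ∩ halfSpace e T) = 0 :=
    le_antisymm ((measureReal_le_tailMass hΩ hw2 e T).trans hT.le) measureReal_nonneg
  exact (measureReal_eq_zero_iff ((measure_mono Set.inter_subset_left).trans_lt hΩ).ne).1 h0

lemma norm_le_sum_abs (x : Euc d) : ‖x‖ ≤ ∑ i, |x i| := by
  conv_lhs => rw [← (EuclideanSpace.basisFun (Fin d) ℝ).sum_repr x]
  refine (norm_sum_le _ _).trans (Finset.sum_le_sum fun i _ => ?_)
  simp [norm_smul]

end Iteration

/-- The directions ± each basis vector confine Ω to a box up to a null set. Dimension 0 is separate,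
because the volume of balls does not grow with the radius there. -/
theorem lemma3 {d : ℕ} (Ω : Set (Euc d)) (hΩ : IsEnergySubsolution Ω) :
    ∃ R : ℝ, volume (Ω \ ball (0 : Euc d) R) = 0 := by
  rcases Nat.eq_zero_or_pos d with rfl | hd
  · refine ⟨1, ?_⟩
    have : Ω \ ball (0 : Euc 0) 1 = ∅ := by
      ext x
      simp [Subsingleton.elim x 0]
    rw [this, measure_empty]
  have hp : ∀ i : Fin d, ∃ T : ℝ, volume (Ω ∩ halfSpace (EuclideanSpace.single i 1) T) = 0 :=
    fun i => hΩ.exists_volume_inter_halfSpace_eq_zero hd (by simp)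
  have hn : ∀ i : Fin d, ∃ T : ℝ, volume (Ω ∩ halfSpace (-EuclideanSpace.single i 1) T) = 0 :=
    fun i => hΩ.exists_volume_inter_halfSpace_eq_zero hd (by simp)
  choose T hT using hp
  choose T' hT' using hn
  refine ⟨(∑ i, max (T i) (T' i)) + 1, ?_⟩
  refine measure_mono_null (t := (⋃ i, Ω ∩ halfSpace (EuclideanSpace.single i 1) (T i)) ∪
    ⋃ i, Ω ∩ halfSpace (-EuclideanSpace.single i 1) (T' i)) ?_
    (measure_union_null (measure_iUnion_null hT) (measure_iUnion_null hT'))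
  rintro x ⟨hxΩ, hxB⟩
  by_contra hx
  simp only [Set.mem_union, Set.mem_iUnion, Set.mem_inter_iff, hxΩ, true_and, mem_halfSpace,
    not_or, not_exists, not_lt, inner_neg_left, EuclideanSpace.inner_single_left, map_one,
    one_mul] at hx
  refine hxB ?_
  rw [mem_ball_zero_iff]
  refine (norm_le_sum_abs x).trans_lt (lt_of_le_of_lt (Finset.sum_le_sum fun i _ => ?_)
    (lt_add_one _))
  exact abs_le'.2 ⟨(hx.1 i).trans (le_max_left _ _), (hx.2 i).trans (le_max_right _ _)⟩
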